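/- **Setting.** Let $q\ge 2$, $n\ge 1$. A variational circuit $U(\theta)$, $\theta\in[0,2\pi]^p$, acts on $n$ qudits of dimension $q$ started in $|0^n\rangle$. It contains $m$ entangling gates $V_1,\dots,V_m$ in time order, each acting on an arbitrary pair of distinct sites, such that every qudit is acted on by at least one of them. The $V_t$ are independent, each drawn from a probability measure on $\mathrm U(q^2)$ that is a unitary 2-design. Each entangling gate is immediately preceded and succeeded by arbitrarily many parameterized gates $W_l e^{-iA\theta_k}W_r$ on one or both of its sites ($A$ Hermitian, $\theta\mapsto e^{-iA\theta}$ of period $2\pi$, $W_l,W_r$ fixed unitaries); there are no other gates. Let $M_0=I,M_1,\dots,M_{q^2-1}\in\mathbb C^{q\times q}$ satisfy $\mathrm{tr}(M_i^\dagger M_j)=q\,\delta_{ij}$, and for $\mathbf x\in\{0,\dots,q^2-1\}^n$ put $M_{\mathbf x}=M_{\mathbf x_1}\otimes\cdots\otimes M_{\mathbf x_n}$ and $\mathrm{supp}(\mathbf x)=\{k:\mathbf x_k\ne0\}$. Let $H=\sum_{\mathbf x}c_{\mathbf x}M_{\mathbf x}$ be a nonzero Hermitian operator, $S=\sum_{\mathbf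 x}|c_{\mathbf x}|^2$, and $f_V(\theta)=\langle 0^n|U(\theta)^\dagger H\,U(\theta)|0^n\rangle$. Let $\mathbb E_V$ be the expectation over the entangling gates and $\mathbb E_\theta$ the average over uniform $\theta\in[0,2\pi]^p$. The *biased random walk* on $\{\mathtt I,\mathtt S\}^n$ starts with each site independently labelled $\mathtt S$ with probability $1/(q+1)$ and $\mathtt I$ otherwise. Then the entangling gates act in order: a gate leaves two equal labels unchanged, and turns two different labels into $(\mathtt S,\mathtt S)$ with probability $1/(q^2+1)$ and into $(\mathtt I,\mathtt I)$ otherwise. Let $\Gamma^m$ be the final configuration and $\mathrm{supp}(\Gamma^m)$ the set of sites labelled $\mathtt S$. **Algorithm.** Given the circuit, the number $S$, an oracle that returns independent samples $\mathbf X$ with $\Pr[\mathbf X=\mathbf x]=|c_{\mathbf x}|^2/S$, and $\varepsilon>0$, $0<\delta<1$, put $N=\left\lceil\tfrac12\log(2/\delta)\,(S/\varepsilon)^2\right\rceil$. For $i=1,\dots,N$, simulate the walk to sample $\Gamma^m$, draw $\mathbf X$, and set $a_i=1$ if $\mathrm{supp}(\mathbf X)\subseteq\mathrm{supp}(\Gamma^m)$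 and $a_i=0$ otherwise. Return $S\,N^{-1}\sum_{i=1}^N a_i$. The algorithm is implemented by an explicit program for a randomized random-access machine with integer and real registers. Each elementary operation (reading or writing a register or array cell, comparison, real arithmetic, logarithm, rounding up, a biased coin flip, incrementing a loop counter) costs one unit, and an oracle draw of $\mathbf X$ costs $n+1$ units. **Theorem.** There is an absolute constant $C>0$ such that for all such data: 1. The output of the program is distributed as $S\,N^{-1}\sum_{i=1}^N a_i$ with $a_1,\dots,a_N$ independent copies of the indicator of $\mathrm{supp}(\mathbf X)\subseteq\mathrm{supp}(\Gamma^m)$, where $\mathbf X$ and $\Gamma^m$ are independent. 2. With probability at least $1-\delta$ the output differs from $\mathbb E_V\mathbb E_\theta f_V(\theta)^2$ by at most $\varepsilon$. 3. The running time is, with certainty, at most $C\,m\,N$; in particular, if $\varepsilon\le S$ and $\delta\le\frac12$, it is at most $C\,m\,S^2\log(1/\delta)\,\varepsilon^{-2}$. -/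

import Mathlib

open MeasureTheory
open scoped ENNReal

namespace BarrenPlateau

noncomputable section

/-! ### Random unitaries and 2-designs -/

section Unitary

variable {ι : Type} [Fintype ι] [DecidableEq ι]

instance : MeasurableSpace (Matrix.unitaryGroup ι ℂ) := borel _

instance : BorelSpace (Matrix.unitaryGroup ι ℂ) := ⟨rfl⟩

instance : CompactSpace (Matrix.unitaryGroup ι ℂ) := by
  have hK : IsCompact (Set.univ.pi fun _ : ι => Set.univ.pi fun _ : ι =>
      Metric.closedBall (0 : ℂ) 1) :=
    isCompact_univ_pi fun _ => isCompact_univ_pi fun _ => isCompact_closedBall _ _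
  have hc : IsClosed ((Matrix.unitaryGroup ι ℂ : Set (Matrix ι ι ℂ))) := isClosed_unitary
  refine isCompact_iff_compactSpace.mp (hK.of_isClosed_subset hc ?_)
  intro U hU i _ j _
  simpa using entry_norm_bound_of_unitary hU i j

/-- The Haar probability measure on the unitary group. -/
def haarUnitary (ι : Type) [Fintype ι] [DecidableEq ι] : Measure (Matrix.unitaryGroup ι ℂ) :=
  Measure.haarMeasure ⊤

/-- `μ` is a unitary 2-design: a probability measure whose moment operator
`𝔼 [U ⊗ U ⊗ Ū ⊗ Ū]` coincides, entry by entry, with that of the Haar measure. -/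
def IsTwoDesign (μ : Measure (Matrix.unitaryGroup ι ℂ)) : Prop :=
  IsProbabilityMeasure μ ∧
    ∀ a₁ a₂ a₃ a₄ b₁ b₂ b₃ b₄ : ι,
      ∫ U, (U : Matrix ι ι ℂ) a₁ b₁ * (U : Matrix ι ι ℂ) a₂ b₂ *
          star ((U : Matrix ι ι ℂ) a₃ b₃) * star ((U : Matrix ι ι ℂ) a₄ b₄) ∂μ =
        ∫ U, (U : Matrix ι ι ℂ) a₁ b₁ * (U : Matrix ι ι ℂ) a₂ b₂ *
          star ((U : Matrix ι ι ℂ) a₃ b₃) * star ((U : Matrix ι ι ℂ) a₄ b₄) ∂(haarUnitary ι)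

end Unitary

/-! ### Variational circuits

The computational basis of `n` qudits of dimension `q` is indexed by `Fin n → Fin q`, and
`Fin q × Fin q` indexes the basis of a pair of qudits. -/

/-- Operators on the space of two qudits. -/
abbrev TwoSiteOp (q : ℕ) := Matrix (Fin q × Fin q) (Fin q × Fin q) ℂ

/-- Operators on the space of `n` qudits. -/
abbrev QuditOp (n q : ℕ) := Matrix (Fin n → Fin q) (Fin n → Fin q) ℂ

/-- The operator on `n` qudits acting as `G` on the ordered pair of sites `(i, j)` (with `i ≠ j`)
and as the identity on the other sites. -/
def embed {n q : ℕ} (i j : Fin n) (G : TwoSiteOp q) : QuditOp n q :=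
  fun x y => if ∀ k, k ≠ i → k ≠ j → x k = y k then G (x i, x j) (y i, y j) else 0

/-- A parameterized gate `W_l e^{-iAθ} W_r` on a pair of sites, with `θ ↦ e^{-iAθ}` of period
`2π`. A gate acting on only one of the two sites is one with `A = a ⊗ 1` or `A = 1 ⊗ a`, and
likewise for `W_l` and `W_r`. The field `param` says which of the `p` parameters `θ` is. -/
structure ParamGate (q p : ℕ) where
  gen : TwoSiteOp q
  isHermitian : gen.IsHermitian
  periodic : ∀ θ : ℝ, NormedSpace.exp ((-Complex.I * ((θ + 2 * Real.pi : ℝ) : ℂ)) • gen) =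
    NormedSpace.exp ((-Complex.I * (θ : ℂ)) • gen)
  left : Matrix.unitaryGroup (Fin q × Fin q) ℂ
  right : Matrix.unitaryGroup (Fin q × Fin q) ℂ
  param : Fin p

/-- The matrix of a parameterized gate. -/
def ParamGate.mat {q p : ℕ} (g : ParamGate q p) (θ : Fin p → ℝ) : TwoSiteOp q :=
  (g.left : TwoSiteOp q) * NormedSpace.exp ((-Complex.I * (θ g.param : ℂ)) • g.gen) *
    (g.right : TwoSiteOp q)

/-- The product of a list of parameterized gates on one pair of sites, earliest gate first. -/
def seqMat {q p : ℕ} (l : List (ParamGate q p)) (θ : Fin p → ℝ) : TwoSiteOp q :=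
  l.foldl (fun acc g => g.mat θ * acc) 1

/-- An entangling gate on the sites `fst ≠ snd`, with the parameterized gates on one or both of
these two sites that immediately precede it (`pre`) and succeed it (`post`), in time order. -/
structure Block (n q p : ℕ) where
  fst : Fin n
  snd : Fin n
  ne : fst ≠ snd
  pre : List (ParamGate q p)
  post : List (ParamGate q p)

/-- A variational circuit on `n` qudits of dimension `q` with `m` entangling gates and `p`
parameters: entangling gates in time order, on arbitrary pairs of sites, each preceded and
succeeded by parameterized gates on its sites, such that each qudit is acted on by an entangling
gate at least once. -/
structure Circuit (n q m p : ℕ) where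
  block : Fin m → Block n q p
  covers : ∀ k : Fin n, ∃ t, k = (block t).fst ∨ k = (block t).snd

variable {n q m p : ℕ}

/-- A realization of the `m` entangling gates. -/
abbrev Realization (q m : ℕ) := Fin m → Matrix.unitaryGroup (Fin q × Fin q) ℂ

/-- The operator of the `t`-th block of the circuit. -/
def Circuit.blockMat (U : Circuit n q m p) (V : Realization q m) (θ : Fin p → ℝ) (t : Fin m) :
    QuditOp n q :=
  embed (U.block t).fst (U.block t).snd
    (seqMat (U.block t).post θ * (V t : TwoSiteOp q) * seqMat (U.block t).pre θ)

/-- The operator `U(θ)` of the whole circuit; the block `0` acts first. -/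
def Circuit.mat (U : Circuit n q m p) (V : Realization q m) (θ : Fin p → ℝ) : QuditOp n q :=
  (List.finRange m).foldl (fun acc t => U.blockMat V θ t * acc) 1

/-- The objective function `f_V(θ) = ⟨0ⁿ| U(θ)† H U(θ) |0ⁿ⟩`. -/
def Circuit.objective [NeZero q] (U : Circuit n q m p) (H : QuditOp n q) (V : Realization q m)
    (θ : Fin p → ℝ) : ℝ :=
  (((U.mat V θ).conjTranspose * H * U.mat V θ) (fun _ => 0) (fun _ => 0)).re

/-- `𝔼_V 𝔼_θ f_V(θ)²`: the entangling gates are independent, the `t`-th one with law `μ t`, and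
`θ` is uniform on `[0, 2π]^p`. -/
def Circuit.secondMoment [NeZero q] (U : Circuit n q m p)
    (μ : Fin m → Measure (Matrix.unitaryGroup (Fin q × Fin q) ℂ)) (H : QuditOp n q) : ℝ :=
  ∫ V, (⨍ θ in Set.Icc (0 : Fin p → ℝ) (fun _ => 2 * Real.pi), U.objective H V θ ^ 2)
    ∂(Measure.pi μ)

/-! ### The observable -/

/-- Matrices `M_0 = 1, M_1, …, M_{q²-1}` with `tr (M_i† M_j) = q δ_{ij}`. -/
structure OperatorBasis (q : ℕ) [NeZero q] where
  op : Fin (q ^ 2) → Matrix (Fin q) (Fin q) ℂ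
  op_zero : op 0 = 1
  trace_mul : ∀ i j, ((op i).conjTranspose * op j).trace = if i = j then (q : ℂ) else 0

/-- `M_x = M_{x_1} ⊗ ⋯ ⊗ M_{x_n}`. -/
def OperatorBasis.string [NeZero q] (M : OperatorBasis q) (x : Fin n → Fin (q ^ 2)) :
    QuditOp n q :=
  fun a b => ∏ k, M.op (x k) (a k) (b k)

/-- `H = ∑_x c_x M_x`. -/
def OperatorBasis.observable [NeZero q] (M : OperatorBasis q)
    (c : (Fin n → Fin (q ^ 2)) → ℂ) : QuditOp n q :=
  ∑ x, c x • M.string x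

/-- `∑_x |c_x|²`. -/
def weight (c : (Fin n → Fin (q ^ 2)) → ℂ) : ℝ := ∑ x, ‖c x‖ ^ 2

lemma weight_pos {c : (Fin n → Fin (q ^ 2)) → ℂ} (hc : c ≠ 0) : 0 < weight c := by
  obtain ⟨x, hx⟩ := Function.ne_iff.mp hc
  exact Finset.sum_pos' (fun _ _ => by positivity)
    ⟨x, Finset.mem_univ _, by have : 0 < ‖c x‖ := norm_pos_iff.mpr hx
                              positivity⟩

/-- The law of `X`: `Pr[X = x] = |c_x|² / ∑_y |c_y|²`. -/
def coeffPMF (c : (Fin n → Fin (q ^ 2)) → ℂ) (hc : c ≠ 0) : PMF (Fin n → Fin (q ^ 2)) :=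
  PMF.ofFintype (fun x => ENNReal.ofReal (‖c x‖ ^ 2 / weight c)) (by
    have h := weight_pos hc
    rw [← ENNReal.ofReal_sum_of_nonneg (fun x _ => by positivity), ← Finset.sum_div]
    change ENNReal.ofReal (weight c / weight c) = 1
    rw [div_self h.ne', ENNReal.ofReal_one])

/-! ### The biased random walk -/

/-- A coin with `Pr[true] = r`; values of `r` outside `[0, 1]` are clamped. -/
def coin (r : ℝ) : PMF Bool :=
  PMF.ofFintype (fun b => ENNReal.ofReal (if b then max 0 (min r 1) else 1 - max 0 (min r 1))) (by
    have h0 : (0 : ℝ) ≤ max 0 (min r 1) := le_max_left _ _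
    have h1 : max 0 (min r 1) ≤ (1 : ℝ) := max_le zero_le_one (min_le_right _ _)
    rw [Fintype.sum_bool, ← ENNReal.ofReal_add (by simp) (by simp)]
    simp)

/-- A configuration of labels: `true` is the label `S` and `false` is the label `I`. -/
abbrev Config (n : ℕ) := Fin n → Bool

/-- Each site is independently labelled `S` with probability `1/(q+1)`. -/
def initConfig (n q : ℕ) : PMF (Config n) :=
  PMF.ofFintype (fun γ => ∏ k, coin (1 / ((q : ℝ) + 1)) (γ k)) (by
    rw [← Fintype.prod_sum]
    have h : ∑ b, coin (1 / ((q : ℝ) + 1)) b = 1 := by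
      have h' := PMF.tsum_coe (coin (1 / ((q : ℝ) + 1)))
      rwa [tsum_fintype] at h'
    simp only [h, Finset.prod_const_one])

/-- A gate on the sites `i, j` leaves equal labels unchanged, and otherwise makes both of them
`S` with probability `1/(q²+1)` and both of them `I` else. -/
def gateStep (q : ℕ) (i j : Fin n) (γ : Config n) : PMF (Config n) :=
  if γ i = γ j then PMF.pure γ
  else (coin (1 / ((q : ℝ) ^ 2 + 1))).map fun b => Function.update (Function.update γ i b) j b

/-- The law of the final configuration `Γ^m` of the biased random walk of the circuit. -/
def Circuit.finalConfig (U : Circuit n q m p) : PMF (Config n) :=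
  (List.finRange m).foldl
    (fun P t => P.bind (gateStep q (U.block t).fst (U.block t).snd)) (initConfig n q)

/-- The law of one sample `a_i = 𝟙[supp X ⊆ supp Γ^m]`, with `Γ^m` and `X` independent. -/
def Circuit.sample [NeZero q] (U : Circuit n q m p) (c : (Fin n → Fin (q ^ 2)) → ℂ) (hc : c ≠ 0) :
    PMF ℕ :=
  U.finalConfig.bind fun γ => (coeffPMF c hc).map fun x =>
    if ∀ k, x k ≠ 0 → γ k = true then 1 else 0

/-- The law of the sum of `N` independent random variables of law `P`. -/
def sumIID (P : PMF ℕ) : ℕ → PMF ℕ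
  | 0 => PMF.pure 0
  | N + 1 => (sumIID P N).bind fun s => P.map fun a => s + a

/-- The law of `(∑_x |c_x|²) N⁻¹ ∑_{i=1}^N a_i`, with independent samples `a_i`. -/
def Circuit.estimator [NeZero q] (U : Circuit n q m p) (c : (Fin n → Fin (q ^ 2)) → ℂ)
    (hc : c ≠ 0) (N : ℕ) : PMF ℝ :=
  (sumIID (U.sample c hc) N).map fun s => weight c * (N : ℝ)⁻¹ * (s : ℝ)

/-- The number of samples, `½ log (2/δ) (S/ε)²` rounded up, where `S = ∑_x |c_x|²`. -/
def numSamples (S ε δ : ℝ) : ℕ := ⌈(1 / 2) * Real.log (2 / δ) * (S / ε) ^ 2⌉₊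

/-! ### A randomized random-access machine with unit-cost operations

Programs manipulate integer registers, real registers and integer arrays. Every node of an
expression and every command costs one unit of time, except that the command `draw`, which calls
the oracle returning a random string of length `L`, costs `L + 1`. -/

/-- Integer registers. -/
inductive NReg
  | n | m | q | N | i | s | t | u | v | b | hit | count
  deriving DecidableEq

/-- Real registers. -/
inductive RReg
  | S | eps | delta | p0 | p1 | out
  deriving DecidableEq

/-- Arrays of integers. -/
inductive Arr
  | gateFst | gateSnd | label | X
  deriving DecidableEq

/-- The memory of the machine. -/
structure Store where
  nat : NReg → ℕ
  real : RReg → ℝ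
  arr : Arr → ℕ → ℕ

/-- Integer expressions: constants, registers, array cells and sums. -/
inductive NExpr
  | const (k : ℕ)
  | reg (r : NReg)
  | cell (a : Arr) (e : NExpr)
  | add (e₁ e₂ : NExpr)

/-- The value of an integer expression. -/
def NExpr.eval (σ : Store) : NExpr → ℕ
  | const k => k
  | reg r => σ.nat r
  | cell a e => σ.arr a (e.eval σ)
  | add e₁ e₂ => e₁.eval σ + e₂.eval σ

/-- The time needed to evaluate an integer expression. -/
def NExpr.cost : NExpr → ℕ
  | const _ => 1
  | reg _ => 1
  | cell _ e => e.cost + 1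
  | add e₁ e₂ => e₁.cost + e₂.cost + 1

/-- Real expressions. -/
inductive RExpr
  | ofNat (e : NExpr)
  | reg (r : RReg)
  | add (e₁ e₂ : RExpr)
  | mul (e₁ e₂ : RExpr)
  | div (e₁ e₂ : RExpr)
  | log (e : RExpr)

/-- The value of a real expression. -/
def RExpr.eval (σ : Store) : RExpr → ℝ
  | ofNat e => (e.eval σ : ℝ)
  | reg r => σ.real r
  | add e₁ e₂ => e₁.eval σ + e₂.eval σ
  | mul e₁ e₂ => e₁.eval σ * e₂.eval σ
  | div e₁ e₂ => e₁.eval σ / e₂.eval σ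
  | log e => Real.log (e.eval σ)

/-- The time needed to evaluate a real expression. -/
def RExpr.cost : RExpr → ℕ
  | ofNat e => e.cost + 1
  | reg _ => 1
  | add e₁ e₂ => e₁.cost + e₂.cost + 1
  | mul e₁ e₂ => e₁.cost + e₂.cost + 1
  | div e₁ e₂ => e₁.cost + e₂.cost + 1
  | log e => e.cost + 1

/-- Commands. `setN`, `setR`, `setCell` are assignments, `ceil r e` puts `⌈e⌉` into `r`,
`flip r e` sets `r` to `1` with probability `e` and to `0` otherwise, `draw a` writes a fresh
string from the oracle into the array `a`, `ifEq e₁ e₂ c₁ c₂` runs `c₁` if `e₁ = e₂` and `c₂`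
otherwise, and `loop r e c` runs `c` for `r = 0, 1, …, e - 1`. -/
inductive Cmd
  | skip
  | setN (r : NReg) (e : NExpr)
  | setR (r : RReg) (e : RExpr)
  | setCell (a : Arr) (e₁ e₂ : NExpr)
  | ceil (r : NReg) (e : RExpr)
  | flip (r : NReg) (e : RExpr)
  | draw (a : Arr)
  | seq (c₁ c₂ : Cmd)
  | ifEq (e₁ e₂ : NExpr) (c₁ c₂ : Cmd)
  | loop (r : NReg) (e : NExpr) (c : Cmd)

namespace Store

def setN (σ : Store) (r : NReg) (k : ℕ) : Store := { σ with nat := Function.update σ.nat r k }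

def setR (σ : Store) (r : RReg) (x : ℝ) : Store := { σ with real := Function.update σ.real r x }

def setArr (σ : Store) (a : Arr) (f : ℕ → ℕ) : Store :=
  { σ with arr := Function.update σ.arr a f }

end Store

/-- Runs `body` for `r = 0, …, K - 1`, with one unit of time per iteration for the counter. -/
def runLoop (body : Store → PMF (Store × ℕ)) (r : NReg) (σ : Store) : ℕ → PMF (Store × ℕ)
  | 0 => PMF.pure (σ, 0)
  | K + 1 => (runLoop body r σ K).bind fun o =>
      (body (o.1.setN r K)).map fun o' => (o'.1, o.2 + o'.2 + 1)

/-- The joint law of the final memory and of the running time of a command started in memory `σ`,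
when the oracle draws independent strings of law `D`. -/
def Cmd.run {L : ℕ} (D : PMF (Fin L → ℕ)) : Cmd → Store → PMF (Store × ℕ)
  | skip, σ => PMF.pure (σ, 1)
  | setN r e, σ => PMF.pure (σ.setN r (e.eval σ), e.cost + 1)
  | setR r e, σ => PMF.pure (σ.setR r (e.eval σ), e.cost + 1)
  | setCell a e₁ e₂, σ =>
      PMF.pure (σ.setArr a (Function.update (σ.arr a) (e₁.eval σ) (e₂.eval σ)),
        e₁.cost + e₂.cost + 1)
  | ceil r e, σ => PMF.pure (σ.setN r ⌈e.eval σ⌉₊, e.cost + 1)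
  | flip r e, σ => (coin (e.eval σ)).map fun b => (σ.setN r (if b then 1 else 0), e.cost + 1)
  | draw a, σ => D.map fun x =>
      (σ.setArr a (fun k => if h : k < L then x ⟨k, h⟩ else σ.arr a k), L + 1)
  | seq c₁ c₂, σ => (c₁.run D σ).bind fun o =>
      (c₂.run D o.1).map fun o' => (o'.1, o.2 + o'.2 + 1)
  | ifEq e₁ e₂ c₁ c₂, σ =>
      (if e₁.eval σ = e₂.eval σ then c₁.run D σ else c₂.run D σ).map fun o =>
        (o.1, o.2 + e₁.cost + e₂.cost + 1)
  | loop r e c, σ => (runLoop (c.run D) r σ (e.eval σ)).map fun o => (o.1, o.2 + e.cost + 1)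

/-! ### The Monte Carlo algorithm as a program -/

/-- Runs a list of commands in order. -/
def Cmd.block : List Cmd → Cmd
  | [] => .skip
  | c :: l => .seq c (Cmd.block l)

/-- `N ← ⌈½ log (2/δ) (S/ε)²⌉` together with the flip probabilities of the walk,
`p0 = 1/(q+1)` and `p1 = 1/(q²+1)`. -/
def setup : Cmd :=
  .block [
    .ceil .N (.mul (.mul (.div (.ofNat (.const 1)) (.ofNat (.const 2)))
      (.log (.div (.ofNat (.const 2)) (.reg .delta))))
      (.mul (.div (.reg .S) (.reg .eps)) (.div (.reg .S) (.reg .eps)))),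
    .setR .p0 (.div (.ofNat (.const 1)) (.add (.ofNat (.reg .q)) (.ofNat (.const 1)))),
    .setR .p1 (.div (.ofNat (.const 1))
      (.add (.mul (.ofNat (.reg .q)) (.ofNat (.reg .q))) (.ofNat (.const 1)))),
    .setN .count (.const 0)]

/-- Simulates the biased walk; the array `label` ends up holding `Γ^m` (`1` for `S`, `0` for
`I`). -/
def simulateWalk : Cmd :=
  .block [
    .loop .s (.reg .n) (.block [
      .flip .b (.reg .p0),
      .setCell .label (.reg .s) (.reg .b)]),
    .loop .t (.reg .m) (.block [
      .setN .u (.cell .gateFst (.reg .t)),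
      .setN .v (.cell .gateSnd (.reg .t)),
      .ifEq (.cell .label (.reg .u)) (.cell .label (.reg .v)) .skip (.block [
        .flip .b (.reg .p1),
        .setCell .label (.reg .u) (.reg .b),
        .setCell .label (.reg .v) (.reg .b)])])]

/-- `hit ← 𝟙[supp X ⊆ supp Γ^m]`. -/
def testSupport : Cmd :=
  .block [
    .setN .hit (.const 1),
    .loop .s (.reg .n)
      (.ifEq (.cell .X (.reg .s)) (.const 0) .skip
        (.ifEq (.cell .label (.reg .s)) (.const 1) .skip (.setN .hit (.const 0))))]

/-- The whole algorithm; the result is left in the register `out`. -/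
def monteCarlo : Cmd :=
  .block [
    setup,
    .loop .i (.reg .N) (.block [
      simulateWalk,
      .draw .X,
      testSupport,
      .setN .count (.add (.reg .count) (.reg .hit))]),
    .setR .out (.mul (.mul (.reg .S) (.div (.ofNat (.const 1)) (.ofNat (.reg .N))))
      (.ofNat (.reg .count)))]

/-- The memory holding the input: `n`, `m`, `q`, the list of the sites of the entangling gates,
`S = ∑_x |c_x|²`, `ε` and `δ`. -/
def Circuit.input (U : Circuit n q m p) (S ε δ : ℝ) : Store where
  nat
    | .n => n
    | .m => m
    | .q => q
    | _ => 0
  real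
    | .S => S
    | .eps => ε
    | .delta => δ
    | _ => 0
  arr
    | .gateFst => fun t => if h : t < m then ((U.block ⟨t, h⟩).fst : ℕ) else 0
    | .gateSnd => fun t => if h : t < m then ((U.block ⟨t, h⟩).snd : ℕ) else 0
    | _ => fun _ => 0

/-- The joint law of final memory and running time of the algorithm on the circuit `U` and the
observable `H = ∑_x c_x M_x`, to which it has access through the number `∑_x |c_x|²` and an oracle
drawing `X` with probability proportional to `|c_x|²`. -/
def Circuit.runMonteCarlo (U : Circuit n q m p) (c : (Fin n → Fin (q ^ 2)) → ℂ)
    (hc : c ≠ 0) (ε δ : ℝ) : PMF (Store × ℕ) :=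
  monteCarlo.run ((coeffPMF c hc).map fun x k => (x k : ℕ)) (U.input (weight c) ε δ)

end

end BarrenPlateau

open BarrenPlateau

/-!
Fix `θ` and average over the entangling gates. Expanding `H` in strings, `f²` is a sum of products
over the sites of single-site functionals evaluated on `ψ ⊗ ψ ⊗ ψ̄ ⊗ ψ̄`. Averaging over the last
gate, a 2-design unaffected by the unitaries around it, projects the functionals of its two sites
onto the span of `pairing false ⊗ pairing false` and `pairing true ⊗ pairing true`, with Weingarten
coefficients. Evaluated on normalized pairings indexed by the labels of the walk, this projection
is the adjoint of one step of the walk, and `|0⟩⟨0|` acts on pairings as its random initial label.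
Hence `𝔼_V f²` is an expectation over `Γ^m`: orthogonality of the `M_i` annihilates products of
distinct strings, and the product of `M_x` with itself contributes `𝟙[supp x ⊆ supp Γ^m]`. The
result, `∑_x |c_x|² Pr[supp x ⊆ supp Γ^m]`, does not depend on `θ` and is `S` times the mean of the
sampled indicator, so Hoeffding's inequality bounds the error.

The output law and the running time of the program come together from a Hoare logic whose
judgement couples the final store with a value drawn from a given law and bounds the cost of every
run.
-/

namespace BarrenPlateau

noncomputable section

open scoped Kronecker Matrix
open Function (update update_self update_of_ne)

/-! ### Second moments of a 2-design -/

section Invariants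

variable {ι : Type*}

/-- Indices of a tensor in `V ⊗ V ⊗ V̄ ⊗ V̄`: two ket indices followed by two bra indices. -/
abbrev Quad (ι : Type*) := ι × ι × ι × ι

/-- The moment matrix `U ⊗ U ⊗ Ū ⊗ Ū`, whose entries are the quantities averaged in the
definition of a 2-design. -/
def momentMat (U : Matrix ι ι ℂ) : Matrix (Quad ι) (Quad ι) ℂ :=
  U ⊗ₖ (U ⊗ₖ (U.map star ⊗ₖ U.map star))

lemma momentMat_apply (U : Matrix ι ι ℂ) (a b : Quad ι) :
    momentMat U a b = U a.1 b.1 * (U a.2.1 b.2.1 *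
      (star (U a.2.2.1 b.2.2.1) * star (U a.2.2.2 b.2.2.2))) := rfl

/-- The two ways of pairing kets with bras: the tensor `δ₁₃ δ₂₄` for the label `I` (`false`) and
`δ₁₄ δ₂₃` for the label `S` (`true`). -/
def pairing [DecidableEq ι] : Bool → Quad ι → ℂ
  | false, a => (if a.1 = a.2.2.1 then 1 else 0) * (if a.2.1 = a.2.2.2 then 1 else 0)
  | true, a => (if a.1 = a.2.2.2 then 1 else 0) * (if a.2.1 = a.2.2.1 then 1 else 0)

variable [Fintype ι]

lemma momentMat_mul (U V : Matrix ι ι ℂ) : momentMat (U * V) = momentMat U * momentMat V := by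
  have h : (U * V).map star = U.map star * V.map star := by
    ext i j
    simp [Matrix.mul_apply]
  simp only [momentMat, h, Matrix.mul_kronecker_mul]

variable [DecidableEq ι]

lemma sum_row_mul_star {U : Matrix ι ι ℂ} (hU : U ∈ Matrix.unitaryGroup ι ℂ) (a b : ι) :
    ∑ c, U a c * star (U b c) = if a = b then 1 else 0 := by
  have h := congrFun₂ (Matrix.mem_unitaryGroup_iff.mp hU) a b
  simpa [Matrix.mul_apply, Matrix.one_apply] using h

/-- A tensor in `V ⊗ V ⊗ V̄ ⊗ V̄` that is fixed by `U ⊗ U ⊗ Ū ⊗ Ū` for every unitary `U`. -/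
def IsMomentInvariant (X : Quad ι → ℂ) : Prop :=
  ∀ U ∈ Matrix.unitaryGroup ι ℂ, momentMat U *ᵥ X = X

lemma isMomentInvariant_pairing (l : Bool) : IsMomentInvariant (pairing l : Quad ι → ℂ) := by
  intro U hU
  ext ⟨a₁, a₂, a₃, a₄⟩
  simp only [Matrix.mulVec, dotProduct, momentMat_apply, Fintype.sum_prod_type]
  cases l
  · calc _ = ∑ c, ∑ c', U a₁ c * (U a₂ c' * (star (U a₃ c) * star (U a₄ c'))) := by
          simp [pairing]
      _ = (∑ c, U a₁ c * star (U a₃ c)) * ∑ c, U a₂ c * star (U a₄ c) := by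
          rw [Finset.sum_mul_sum]
          exact Finset.sum_congr rfl fun _ _ => Finset.sum_congr rfl fun _ _ => by ring
      _ = pairing false (a₁, a₂, a₃, a₄) := by simp only [sum_row_mul_star hU, pairing]
  · calc _ = ∑ c, ∑ c', U a₁ c * (U a₂ c' * (star (U a₃ c') * star (U a₄ c))) := by
          simp [pairing]
      _ = (∑ c, U a₁ c * star (U a₄ c)) * ∑ c, U a₂ c * star (U a₃ c) := by
          rw [Finset.sum_mul_sum]
          exact Finset.sum_congr rfl fun _ _ => Finset.sum_congr rfl fun _ _ => by ring
      _ = pairing true (a₁, a₂, a₃, a₄) := by simp only [sum_row_mul_star hU, pairing]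

lemma pairing_vecMul_momentMat {U : Matrix ι ι ℂ} (hU : U ∈ Matrix.unitaryGroup ι ℂ) (l : Bool) :
    pairing l ᵥ* momentMat U = pairing l := by
  have hT : (momentMat U).transpose = momentMat U.transpose := rfl
  rw [← Matrix.mulVec_transpose, hT]
  exact isMomentInvariant_pairing l _ (Matrix.transpose_mem_unitaryGroup_iff.mpr hU)

lemma pairing_dotProduct_pairing (l l' : Bool) :
    (pairing l : Quad ι → ℂ) ⬝ᵥ pairing l' =
      if l = l' then (Fintype.card ι : ℂ) ^ 2 else (Fintype.card ι : ℂ) := by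
  cases l <;> cases l' <;>
    simp [dotProduct, pairing, Fintype.sum_prod_type, sq]

lemma diagonal_mem_unitaryGroup {z : ι → ℂ} (hz : ∀ i, z i * star (z i) = 1) :
    Matrix.diagonal z ∈ Matrix.unitaryGroup ι ℂ := by
  rw [Matrix.mem_unitaryGroup_iff, Matrix.star_eq_conjTranspose, Matrix.diagonal_conjTranspose,
    Matrix.diagonal_mul_diagonal, ← Matrix.diagonal_one]
  exact congrArg _ (funext hz)

lemma permMatrix_mem_unitaryGroup (π : Equiv.Perm ι) :
    π.permMatrix ℂ ∈ Matrix.unitaryGroup ι ℂ := by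
  rw [Matrix.mem_unitaryGroup_iff, Matrix.star_eq_conjTranspose, Matrix.conjTranspose_permMatrix,
    ← Matrix.permMatrix_mul, inv_mul_cancel, Matrix.permMatrix_one]

lemma reflection_mem_unitaryGroup {v : ι → ℂ} (hv : star v ⬝ᵥ v ≠ 0) :
    1 - (2 / (star v ⬝ᵥ v)) • Matrix.vecMulVec v (star v) ∈ Matrix.unitaryGroup ι ℂ := by
  set c := 2 / (star v ⬝ᵥ v) with hc
  set P := Matrix.vecMulVec v (star v)
  have hcP : star (c • P) = c • P := by
    have hreal : star c = c := by
      rw [hc, star_div₀, ← Matrix.star_dotProduct_star, star_star, dotProduct_comm, star_ofNat]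
    rw [star_smul, hreal, Matrix.star_eq_conjTranspose, Matrix.conjTranspose_vecMulVec, star_star]
  have hPP : (c • P) * (c • P) = 2 • c • P := by
    rw [smul_mul_smul_comm, Matrix.vecMulVec_mul_vecMulVec, Matrix.vecMulVec_smul, smul_smul,
      ofNat_smul_eq_nsmul ℂ 2 (c • P) |>.symm, smul_smul, mul_assoc]
    congr 1
    simp only [hc]
    field_simp
  rw [Matrix.mem_unitaryGroup_iff, star_sub, star_one, hcP, sub_mul, mul_sub, mul_sub, hPP]
  simp only [one_mul, mul_one]
  abel

namespace IsMomentInvariant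

variable {X : Quad ι → ℂ}

lemma phase_mul (hX : IsMomentInvariant X) {z : ι → ℂ} (hz : ∀ i, z i * star (z i) = 1)
    (a₁ a₂ a₃ a₄ : ι) :
    z a₁ * (z a₂ * (star (z a₃) * star (z a₄))) * X (a₁, a₂, a₃, a₄) = X (a₁, a₂, a₃, a₄) := by
  have h := congrFun (hX _ (diagonal_mem_unitaryGroup hz)) (a₁, a₂, a₃, a₄)
  simp only [Matrix.mulVec, dotProduct, momentMat_apply, Fintype.sum_prod_type,
    Matrix.diagonal_apply, apply_ite star, star_zero] at h
  simpa [Finset.sum_ite_eq, mul_assoc] using h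

lemma apply_perm (hX : IsMomentInvariant X) (π : Equiv.Perm ι) (a₁ a₂ a₃ a₄ : ι) :
    X (π a₁, π a₂, π a₃, π a₄) = X (a₁, a₂, a₃, a₄) := by
  have h := congrFun (hX _ (permMatrix_mem_unitaryGroup π)) (a₁, a₂, a₃, a₄)
  simpa [Matrix.mulVec, dotProduct, momentMat_apply, Fintype.sum_prod_type, apply_ite star,
    PEquiv.toMatrix_apply] using h

/-- Rotating the phase of a single basis vector by `i` multiplies such an entry by a power of `i`
other than `1`. -/
lemma apply_eq_zero (hX : IsMomentInvariant X) {a₁ a₂ a₃ a₄ : ι} (hI : ¬(a₁ = a₃ ∧ a₂ = a₄))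
    (hS : ¬(a₁ = a₄ ∧ a₂ = a₃)) : X (a₁, a₂, a₃, a₄) = 0 := by
  by_contra hne
  have hphase (g : ι) : (if a₁ = g then Complex.I else 1) * ((if a₂ = g then Complex.I else 1) *
      ((if a₃ = g then -Complex.I else 1) * (if a₄ = g then -Complex.I else 1))) = 1 := by
    refine mul_right_cancel₀ hne ?_
    have h := hX.phase_mul (z := fun i => if i = g then Complex.I else 1)
      (fun i => by by_cases h : i = g <;> simp [h]) a₁ a₂ a₃ a₄
    simpa only [apply_ite star, Complex.star_def, Complex.conj_I, map_one, one_mul] using h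
  have hII : Complex.I ≠ 1 := fun h => by simpa using congrArg Complex.re h
  have hII' : -Complex.I ≠ 1 := fun h => by simpa using congrArg Complex.re h
  have h₁ := hphase a₁
  have h₂ := hphase a₂
  have h₃ := hphase a₃
  grind [Complex.I_mul_I]

lemma apply_eq_of_ne (hX : IsMomentInvariant X) {a b e f : ι} (hab : a ≠ b) (hef : e ≠ f) :
    X (a, a, a, a) = X (e, e, e, e) ∧ X (a, b, a, b) = X (e, f, e, f) ∧
      X (a, b, b, a) = X (e, f, f, e) := by
  obtain ⟨π, rfl, rfl⟩ : ∃ π : Equiv.Perm ι, π e = a ∧ π f = b := by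
    refine ⟨Equiv.swap (Equiv.swap e a f) b * Equiv.swap e a, ?_, by simp⟩
    rw [Equiv.Perm.mul_apply, Equiv.swap_apply_left, Equiv.swap_apply_of_ne_of_ne _ hab]
    intro h
    exact hef ((Equiv.swap e a).injective (by simpa using h))
  exact ⟨hX.apply_perm .., hX.apply_perm .., hX.apply_perm ..⟩

/-- The reflection in `e - 2 f` maps `e` to `(3 e + 4 f) / 5`, which mixes the three entries. -/
lemma apply_diag (hX : IsMomentInvariant X) {e f : ι} (hef : e ≠ f) :
    X (e, e, e, e) = X (e, f, e, f) + X (e, f, f, e) := by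
  set v : ι → ℂ := Pi.single e 1 - Pi.single f 2 with hv
  have hvs : star v = v := by
    simp only [hv, star_sub, Pi.star_single, star_one, star_ofNat]
  have hvv : star v ⬝ᵥ v = 5 := by
    rw [hvs, hv]
    simp [dotProduct_sub, hef, hef.symm]
    norm_num
  have hR := reflection_mem_unitaryGroup (v := v) (by rw [hvv]; norm_num)
  rw [hvv, hvs] at hR
  set R : Matrix ι ι ℂ := 1 - (2 / 5 : ℂ) • Matrix.vecMulVec v v with hRdef
  have hrow : R e = Pi.single e (3 / 5) + Pi.single f (4 / 5) := by
    ext c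
    simp only [hRdef, hv, Matrix.sub_apply, Matrix.smul_apply, Matrix.vecMulVec_apply,
      Matrix.one_apply, Pi.sub_apply, Pi.add_apply, Pi.single_apply, hef, smul_eq_mul,
      eq_comm (a := e)]
    split_ifs <;> simp_all <;> norm_num
  have hstar (c : ι) : star (R e c) = R e c := by
    simp only [hrow, Pi.add_apply, Pi.single_apply]
    split_ifs <;> simp
  have hsum (F : ι → ℂ) : ∑ c, R e c * F c = 3 / 5 * F e + 4 / 5 * F f := by
    change R e ⬝ᵥ F = _
    rw [hrow, add_dotProduct, single_dotProduct, single_dotProduct]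
  have h := congrFun (hX R hR) (e, e, e, e)
  simp only [Matrix.mulVec, dotProduct, momentMat_apply, Fintype.sum_prod_type, hstar, mul_assoc,
    ← Finset.mul_sum, hsum] at h
  obtain ⟨hdiag, hI, hS⟩ := hX.apply_eq_of_ne hef.symm hef
  simp only [hdiag, hI, hS, hX.apply_eq_zero, hef, hef.symm, and_true, and_false, not_false_eq_true,
    mul_zero, add_zero, zero_add] at h
  linear_combination (-625 / 288) * h

lemma exists_eq_sum_pairing [Nontrivial ι] (hX : IsMomentInvariant X) :
    ∃ α : Bool → ℂ, X = ∑ l, α l • pairing l := by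
  obtain ⟨e, f, hef⟩ := exists_pair_ne ι
  refine ⟨fun l => if l then X (e, f, f, e) else X (e, f, e, f), ?_⟩
  ext ⟨a₁, a₂, a₃, a₄⟩
  simp only [Fintype.sum_bool, Pi.add_apply, Pi.smul_apply, smul_eq_mul, pairing, if_true,
    Bool.false_eq_true, if_false]
  by_cases hI : a₁ = a₃ ∧ a₂ = a₄
  · obtain ⟨rfl, rfl⟩ := hI
    by_cases h12 : a₁ = a₂
    · subst h12
      have hdiag : X (a₁, a₁, a₁, a₁) = X (e, e, e, e) := by
        simpa using hX.apply_perm (Equiv.swap e a₁) e e e e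
      simp [hdiag, hX.apply_diag hef, add_comm]
    · simp [h12, (hX.apply_eq_of_ne h12 hef).2.1]
  by_cases hS : a₁ = a₄ ∧ a₂ = a₃
  · obtain ⟨rfl, rfl⟩ := hS
    have h12 : a₁ ≠ a₂ := fun h => hI ⟨h, h.symm⟩
    simp [h12, (hX.apply_eq_of_ne h12 hef).2.2]
  rw [hX.apply_eq_zero hI hS]
  grind

end IsMomentInvariant
/-- The Weingarten function of two pairings in dimension `d`: the inverse of their Gram matrix. -/
def wg (d : ℂ) (l l' : Bool) : ℂ :=
  if l = l' then (d ^ 2 - 1)⁻¹ else -(d * (d ^ 2 - 1))⁻¹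

lemma IsMomentInvariant.eq_sum_wg [Nontrivial ι] {X : Quad ι → ℂ} (hX : IsMomentInvariant X) :
    X = ∑ l, (∑ l', wg (Fintype.card ι) l l' * (pairing l' ⬝ᵥ X)) • pairing l := by
  have hd : (Fintype.card ι : ℂ) ≠ 0 := Nat.cast_ne_zero.mpr Fintype.card_ne_zero
  have hd' : (Fintype.card ι : ℂ) ^ 2 - 1 ≠ 0 := by
    rw [sub_ne_zero]
    exact_mod_cast (Nat.one_lt_pow two_ne_zero Fintype.one_lt_card).ne'
  obtain ⟨α, hα⟩ := hX.exists_eq_sum_pairing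
  have hdot (l' : Bool) : pairing l' ⬝ᵥ X = ∑ l, α l *
      if l' = l then (Fintype.card ι : ℂ) ^ 2 else (Fintype.card ι : ℂ) := by
    rw [hα, dotProduct_sum]
    simp only [dotProduct_smul, pairing_dotProduct_pairing, smul_eq_mul]
  have hcoeff (l : Bool) : ∑ l', wg (Fintype.card ι) l l' * (pairing l' ⬝ᵥ X) = α l := by
    cases l <;> simp [hdot, wg] <;> field_simp <;> ring
  simp only [hcoeff, ← hα]

variable (ι) in
/-- The Weingarten matrix: the average of `U ⊗ U ⊗ Ū ⊗ Ū` over the unitary group. -/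
def weingartenMat : Matrix (Quad ι) (Quad ι) ℂ :=
  ∑ l, ∑ l', wg (Fintype.card ι) l l' • Matrix.vecMulVec (pairing l) (pairing l')

lemma weingartenMat_apply (a b : Quad ι) :
    weingartenMat ι a b = ∑ l, ∑ l', wg (Fintype.card ι) l l' * (pairing l a * pairing l' b) := by
  simp only [weingartenMat, Matrix.sum_apply, Matrix.smul_apply, Matrix.vecMulVec_apply,
    smul_eq_mul]

lemma momentMat_mul_weingartenMat_mul {A B : Matrix ι ι ℂ} (hA : A ∈ Matrix.unitaryGroup ι ℂ)
    (hB : B ∈ Matrix.unitaryGroup ι ℂ) :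
    momentMat A * weingartenMat ι * momentMat B = weingartenMat ι := by
  simp only [weingartenMat, Matrix.mul_sum, Matrix.sum_mul, Matrix.mul_smul, Matrix.smul_mul,
    Matrix.mul_vecMulVec, Matrix.vecMulVec_mul, isMomentInvariant_pairing _ A hA,
    pairing_vecMul_momentMat hB]

end Invariants
section Haar

lemma integrable_of_continuous {X E : Type*} [TopologicalSpace X] [CompactSpace X]
    [MeasurableSpace X] [OpensMeasurableSpace X] [NormedAddCommGroup E] {f : X → E}
    (hf : Continuous f) (μ : Measure X) [IsFiniteMeasure μ] : Integrable f μ :=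
  hf.integrable_of_hasCompactSupport (HasCompactSupport.of_compactSpace f)

lemma integral_mul_mul_apply {X l m n o : Type*} [Fintype m] [Fintype n] [MeasurableSpace X]
    {μ : Measure X} (A : Matrix l m ℂ) (B : Matrix n o ℂ) {f : X → Matrix m n ℂ}
    (hf : ∀ i j, Integrable (fun x => f x i j) μ) (i : l) (j : o) :
    ∫ x, (A * f x * B) i j ∂μ = (A * Matrix.of (fun i j => ∫ x, f x i j ∂μ) * B) i j := by
  simp only [Matrix.mul_apply, Matrix.of_apply]
  rw [integral_finsetSum _ fun k _ => (integrable_finsetSum _ fun k' _ =>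
    (hf k' k).const_mul _).mul_const _]
  refine Finset.sum_congr rfl fun k _ => ?_
  rw [integral_mul_const, integral_finsetSum _ fun k' _ => (hf k' k).const_mul _]
  simp only [integral_const_mul]

lemma integrable_momentMat_apply {ι X : Type*} [TopologicalSpace X] [CompactSpace X]
    [MeasurableSpace X] [OpensMeasurableSpace X] {f : X → Matrix ι ι ℂ} (hf : Continuous f)
    (μ : Measure X) [IsFiniteMeasure μ] (a b : Quad ι) :
    Integrable (fun x => momentMat (f x) a b) μ := by
  simp only [momentMat_apply]
  exact integrable_of_continuous ((hf.matrix_elem _ _).mul ((hf.matrix_elem _ _).mul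
    ((hf.matrix_elem _ _).star.mul (hf.matrix_elem _ _).star))) μ

variable {ι : Type} [Fintype ι] [DecidableEq ι]

instance : IsProbabilityMeasure (haarUnitary ι) := ⟨Measure.haarMeasure_self⟩

instance : (haarUnitary ι).IsMulLeftInvariant :=
  inferInstanceAs (Measure.haarMeasure _).IsMulLeftInvariant

lemma isMomentInvariant_integral_haar (b : Quad ι) :
    IsMomentInvariant fun a => ∫ U, momentMat (U : Matrix ι ι ℂ) a b ∂(haarUnitary ι) := by
  intro g hg
  ext a
  calc _ = ∫ U, momentMat (g * (U : Matrix ι ι ℂ)) a b ∂(haarUnitary ι) := by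
        have h := integral_mul_mul_apply (momentMat g) 1
          (integrable_momentMat_apply continuous_subtype_val (haarUnitary ι)) a b
        simp only [mul_one, ← momentMat_mul] at h
        rw [h]
        rfl
    _ = _ := integral_mul_left_eq_self (μ := haarUnitary ι)
        (fun U : Matrix.unitaryGroup ι ℂ => momentMat (U : Matrix ι ι ℂ) a b) ⟨g, hg⟩

lemma pairing_dotProduct_integral (μ : Measure (Matrix.unitaryGroup ι ℂ)) [IsProbabilityMeasure μ]
    (l : Bool) (b : Quad ι) :
    (pairing l ⬝ᵥ fun a => ∫ U, momentMat (U : Matrix ι ι ℂ) a b ∂μ) = pairing l b := by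
  have hU (U : Matrix.unitaryGroup ι ℂ) :
      ∑ a, pairing l a * momentMat (U : Matrix ι ι ℂ) a b = pairing l b :=
    congrFun (pairing_vecMul_momentMat U.2 l) b
  simp only [dotProduct, ← integral_const_mul]
  rw [← integral_finsetSum _ fun a _ =>
    (integrable_momentMat_apply continuous_subtype_val μ a b).const_mul _]
  simp only [hU, integral_const, probReal_univ, one_smul]

lemma integral_momentMat_haar [Nontrivial ι] (a b : Quad ι) :
    ∫ U, momentMat (U : Matrix ι ι ℂ) a b ∂(haarUnitary ι) = weingartenMat ι a b := by
  have h := congrFun (isMomentInvariant_integral_haar b).eq_sum_wg a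
  simp only [pairing_dotProduct_integral, Finset.sum_apply, Pi.smul_apply, smul_eq_mul,
    Finset.sum_mul] at h
  rw [h, weingartenMat_apply]
  exact Finset.sum_congr rfl fun _ _ => Finset.sum_congr rfl fun _ _ => by ring

lemma IsTwoDesign.integral_momentMat [Nontrivial ι] {μ : Measure (Matrix.unitaryGroup ι ℂ)}
    (hμ : IsTwoDesign μ) (a b : Quad ι) :
    ∫ U, momentMat (U : Matrix ι ι ℂ) a b ∂μ = weingartenMat ι a b := by
  rw [← integral_momentMat_haar]
  simpa only [momentMat_apply, mul_assoc] using
    hμ.2 a.1 a.2.1 a.2.2.1 a.2.2.2 b.1 b.2.1 b.2.2.1 b.2.2.2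

lemma IsTwoDesign.integral_momentMat_mul_mul [Nontrivial ι]
    {μ : Measure (Matrix.unitaryGroup ι ℂ)} (hμ : IsTwoDesign μ) {A B : Matrix ι ι ℂ}
    (hA : A ∈ Matrix.unitaryGroup ι ℂ) (hB : B ∈ Matrix.unitaryGroup ι ℂ) (a b : Quad ι) :
    ∫ U, momentMat (A * (U : Matrix ι ι ℂ) * B) a b ∂μ = weingartenMat ι a b := by
  have := hμ.1
  have hΩ : Matrix.of (fun a b => ∫ U, momentMat (U : Matrix ι ι ℂ) a b ∂μ) = weingartenMat ι :=
    Matrix.ext hμ.integral_momentMat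
  simp only [momentMat_mul]
  rw [integral_mul_mul_apply _ _ (integrable_momentMat_apply continuous_subtype_val μ), hΩ,
    momentMat_mul_weingartenMat_mul hA hB]

end Haar

section Update

variable {κ : Type*} [DecidableEq κ] {i j : κ}

lemma update_update_fst {β : Type*} (hij : i ≠ j) (a : κ → β) (b b' : β) :
    update (update a i b) j b' i = b := by
  rw [update_of_ne hij, update_self]

lemma comp_update_update {β γ : Type*} (g : β → γ) (a : κ → β) (i j : κ) (b b' : β) :
    (fun k => g (update (update a i b) j b' k)) =
      update (update (fun k => g (a k)) i (g b)) j (g b') := by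
  change g ∘ _ = _
  rw [Function.comp_update, Function.comp_update]
  rfl

lemma update_update_restore {β : Type*} (a : κ → β) (i j : κ) (b b' : β) :
    update (update (update (update a i b) j b') i (a i)) j (a j) = a := by
  ext k
  by_cases hkj : k = j
  · subst hkj; simp
  · by_cases hki : k = i
    · subst hki; simp [hkj]
    · simp [hkj, hki]

variable [Fintype κ]

lemma prod_eq_mul_mul_prod_erase {M : Type*} [CommMonoid M] (hij : i ≠ j) (f : κ → M) :
    ∏ k, f k = f i * f j * ∏ k ∈ (Finset.univ.erase i).erase j, f k := by
  rw [← Finset.mul_prod_erase _ _ (Finset.mem_univ i),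
    ← Finset.mul_prod_erase _ _ (Finset.mem_erase.mpr ⟨hij.symm, Finset.mem_univ j⟩), ← mul_assoc]

lemma prod_update_update {β M : Type*} [CommMonoid M] (hij : i ≠ j) (F : κ → β → M) (a : κ → β)
    (b b' : β) :
    ∏ k, F k (update (update a i b) j b' k) =
      F i b * F j b' * ∏ k ∈ (Finset.univ.erase i).erase j, F k (a k) := by
  rw [prod_eq_mul_mul_prod_erase hij, update_update_fst hij, update_self]
  congr 1
  refine Finset.prod_congr rfl fun k hk => ?_
  simp only [Finset.mem_erase, Finset.mem_univ, and_true] at hk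
  rw [update_of_ne hk.1, update_of_ne hk.2]

/-- Exchanging the values at two sites with an external pair of values is an involution. -/
lemma sum_sum_update_update {β M : Type*} [Fintype β] [AddCommMonoid M] (hij : i ≠ j)
    (F : (κ → β) → (κ → β) → M) :
    ∑ a, ∑ b : β × β, F a (update (update a i b.1) j b.2) =
      ∑ a, ∑ b : β × β, F (update (update a i b.1) j b.2) a := by
  rw [← Fintype.sum_prod_type', ← Fintype.sum_prod_type']
  let swap : (κ → β) × (β × β) → (κ → β) × (β × β) := fun z =>
    (update (update z.1 i z.2.1) j z.2.2, (z.1 i, z.1 j))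
  have hswap : Function.Involutive swap := by
    rintro ⟨a, b⟩
    simp only [swap, update_update_restore, update_update_fst hij, update_self]
  rw [← Equiv.sum_comp hswap.toPerm]
  refine Finset.sum_congr rfl fun z _ => ?_
  simp only [Function.Involutive.coe_toPerm, swap, update_update_restore]

end Update

/-! ### Averaging over one entangling gate -/

section OneGate

/-- Groups two fourfold indices into one fourfold index of pairs. -/
def quadZip {κ κ' : Type*} : Quad κ × Quad κ' ≃ Quad (κ × κ') where
  toFun a := ((a.1.1, a.2.1), (a.1.2.1, a.2.2.1), (a.1.2.2.1, a.2.2.2.1), (a.1.2.2.2, a.2.2.2.2))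
  invFun b := ((b.1.1, b.2.1.1, b.2.2.1.1, b.2.2.2.1), (b.1.2, b.2.1.2, b.2.2.1.2, b.2.2.2.2))
  left_inv _ := rfl
  right_inv _ := rfl

lemma pairing_quadZip {κ κ' : Type*} [DecidableEq κ] [DecidableEq κ'] (l : Bool)
    (a : Quad κ × Quad κ') : pairing l (quadZip a) = pairing l a.1 * pairing l a.2 := by
  cases l <;> simp [pairing, quadZip, ite_and] <;> split_ifs <;> simp

lemma sum_mul_sum_mul_sum_mul_sum {κ R : Type*} [Fintype κ] [NonUnitalNonAssocSemiring R]
    (f₁ f₂ f₃ f₄ : κ → R) :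
    (∑ b, f₁ b) * ((∑ b, f₂ b) * ((∑ b, f₃ b) * ∑ b, f₄ b)) =
      ∑ b : Quad κ, f₁ b.1 * (f₂ b.2.1 * (f₃ b.2.2.1 * f₄ b.2.2.2)) := by
  simp only [Fintype.sum_prod_type, ← Finset.sum_mul, ← Finset.mul_sum]

/-- The coefficient of `pairing l ⊗ pairing l` in the functional obtained from `O₁ ⊗ O₂` by
averaging over a 2-design on two qudits of dimension `q`. -/
def gateCoeff {q : ℕ} (l : Bool) (O₁ O₂ : Quad (Fin q) → ℂ) : ℂ :=
  ∑ l', wg ((q : ℂ) ^ 2) l' l * ((pairing l' ⬝ᵥ O₁) * (pairing l' ⬝ᵥ O₂))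

variable {n q : ℕ} {i j : Fin n}

lemma sum_mul_weingartenMat_quadZip (O₁ O₂ : Quad (Fin q) → ℂ) (c : Quad (Fin q) × Quad (Fin q)) :
    ∑ b : Quad (Fin q) × Quad (Fin q),
        O₁ b.1 * O₂ b.2 * weingartenMat (Fin q × Fin q) (quadZip b) (quadZip c) =
      ∑ l, gateCoeff l O₁ O₂ * (pairing l c.1 * pairing l c.2) := by
  have hdot (l' : Bool) : (pairing l' ⬝ᵥ O₁) * (pairing l' ⬝ᵥ O₂) =
      ∑ b : Quad (Fin q) × Quad (Fin q), (pairing l' b.1 * O₁ b.1) * (pairing l' b.2 * O₂ b.2) := by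
    rw [dotProduct, dotProduct, Finset.sum_mul_sum, ← Fintype.sum_prod_type']
  have hcard : (Fintype.card (Fin q × Fin q) : ℂ) = (q : ℂ) ^ 2 := by simp [sq]
  simp only [gateCoeff, hdot, weingartenMat_apply, hcard, Fintype.sum_bool,
    pairing_quadZip, Finset.mul_sum, Finset.sum_mul, ← Finset.sum_add_distrib]
  refine Finset.sum_congr rfl fun b _ => ?_
  ring

lemma embed_mulVec (hij : i ≠ j) (G : TwoSiteOp q) (ψ : (Fin n → Fin q) → ℂ) (x : Fin n → Fin q) :
    (embed i j G *ᵥ ψ) x =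
      ∑ b : Fin q × Fin q, G (x i, x j) b * ψ (update (update x i b.1) j b.2) := by
  symm
  refine Finset.sum_of_injOn (fun b : Fin q × Fin q => update (update x i b.1) j b.2) ?_ ?_ ?_ ?_
  · intro b _ b' _ h
    have hi := congrFun h i
    have hj := congrFun h j
    simp only [update_update_fst hij, update_self] at hi hj
    exact Prod.ext hi hj
  · exact fun _ _ => Finset.mem_coe.mpr (Finset.mem_univ _)
  · intro y _ hy
    have hne : ¬∀ k, k ≠ i → k ≠ j → x k = y k := by
      refine fun h => hy ⟨(y i, y j), by simp, ?_⟩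
      ext k
      by_cases hkj : k = j
      · subst hkj; simp
      · by_cases hki : k = i
        · subst hki; simp [hkj]
        · simp [hkj, hki, h k hki hkj]
    simp only [embed]
    rw [if_neg hne, zero_mul]
  · intro b _
    have heq : ∀ k, k ≠ i → k ≠ j → x k = update (update x i b.1) j b.2 k := fun k hki hkj => by
      rw [update_of_ne hkj, update_of_ne hki]
    simp only [embed]
    rw [if_pos heq, update_update_fst hij, update_self]

/-- The tensor `ψ ⊗ ψ ⊗ ψ̄ ⊗ ψ̄`, with the four indices of each site grouped together. -/
def copies (ψ : (Fin n → Fin q) → ℂ) (a : Fin n → Quad (Fin q)) : ℂ :=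
  ψ (fun k => (a k).1) * (ψ (fun k => (a k).2.1) *
    (star (ψ fun k => (a k).2.2.1) * star (ψ fun k => (a k).2.2.2)))

lemma copies_embed_mulVec (hij : i ≠ j) (G : TwoSiteOp q) (ψ : (Fin n → Fin q) → ℂ)
    (a : Fin n → Quad (Fin q)) :
    copies (embed i j G *ᵥ ψ) a = ∑ b : Quad (Fin q) × Quad (Fin q),
      momentMat G (quadZip (a i, a j)) (quadZip b) *
        copies ψ (update (update a i b.1) j b.2) := by
  rw [← Equiv.sum_comp quadZip.symm]
  simp only [copies, embed_mulVec hij, star_sum, sum_mul_sum_mul_sum_mul_sum,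
    Equiv.apply_symm_apply]
  refine Finset.sum_congr rfl fun b _ => ?_
  simp only [comp_update_update (fun c : Quad (Fin q) => c.1),
    comp_update_update (fun c : Quad (Fin q) => c.2.1),
    comp_update_update (fun c : Quad (Fin q) => c.2.2.1),
    comp_update_update (fun c : Quad (Fin q) => c.2.2.2), momentMat_apply, star_mul',
    quadZip, Equiv.coe_fn_mk, Equiv.coe_fn_symm_mk]
  ring

/-- The value of the product functional `⊗ₖ O k` on `ψ ⊗ ψ ⊗ ψ̄ ⊗ ψ̄`. -/
def expval (ψ : (Fin n → Fin q) → ℂ) (O : Fin n → Quad (Fin q) → ℂ) : ℂ :=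
  ∑ a, copies ψ a * ∏ k, O k (a k)

lemma continuous_expval {X : Type*} [TopologicalSpace X] {ψ : X → (Fin n → Fin q) → ℂ}
    (hψ : Continuous ψ) (O : Fin n → Quad (Fin q) → ℂ) : Continuous fun V => expval (ψ V) O := by
  have h (x : Fin n → Fin q) : Continuous fun V => ψ V x := (continuous_apply x).comp hψ
  exact continuous_finsetSum _ fun a _ =>
    ((h _).mul ((h _).mul ((h _).star.mul (h _).star))).mul continuous_const

lemma expval_embed_mulVec (hij : i ≠ j) (G : TwoSiteOp q) (ψ : (Fin n → Fin q) → ℂ)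
    (O : Fin n → Quad (Fin q) → ℂ) :
    expval (embed i j G *ᵥ ψ) O = ∑ a, copies ψ a *
      ((∑ b : Quad (Fin q) × Quad (Fin q),
        O i b.1 * O j b.2 * momentMat G (quadZip b) (quadZip (a i, a j))) *
        ∏ k ∈ (Finset.univ.erase i).erase j, O k (a k)) := by
  let F (a a' : Fin n → Quad (Fin q)) : ℂ :=
    momentMat G (quadZip (a i, a j)) (quadZip (a' i, a' j)) * copies ψ a' * ∏ k, O k (a k)
  calc expval (embed i j G *ᵥ ψ) O
      = ∑ a, ∑ b : Quad (Fin q) × Quad (Fin q), F a (update (update a i b.1) j b.2) := by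
        simp only [expval, F, copies_embed_mulVec hij, Finset.sum_mul, update_update_fst hij,
          update_self]
    _ = ∑ a, ∑ b : Quad (Fin q) × Quad (Fin q), F (update (update a i b.1) j b.2) a :=
        sum_sum_update_update hij F
    _ = _ := by
        refine Finset.sum_congr rfl fun a _ => ?_
        simp only [F, prod_update_update hij (fun k => O k), update_update_fst hij, update_self,
          Finset.sum_mul, Finset.mul_sum]
        exact Finset.sum_congr rfl fun b _ => by ring

lemma IsTwoDesign.integral_expval_embed (hij : i ≠ j) (hq : 2 ≤ q)
    {μ : Measure (Matrix.unitaryGroup (Fin q × Fin q) ℂ)} (hμ : IsTwoDesign μ)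
    {A B : TwoSiteOp q} (hA : A ∈ Matrix.unitaryGroup (Fin q × Fin q) ℂ)
    (hB : B ∈ Matrix.unitaryGroup (Fin q × Fin q) ℂ) (ψ : (Fin n → Fin q) → ℂ)
    (O : Fin n → Quad (Fin q) → ℂ) :
    ∫ V, expval (embed i j (A * (V : TwoSiteOp q) * B) *ᵥ ψ) O ∂μ =
      ∑ l, gateCoeff l (O i) (O j) * expval ψ (update (update O i (pairing l)) j (pairing l)) := by
  have := hμ.1
  have : Nontrivial (Fin q) := Fin.nontrivial_iff_two_le.mpr hq
  have hint := integrable_momentMat_apply (X := Matrix.unitaryGroup (Fin q × Fin q) ℂ)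
    (f := fun V => A * (V : TwoSiteOp q) * B) (by fun_prop) μ
  have hprod (l : Bool) (a : Fin n → Quad (Fin q)) :
      ∏ k, update (update O i (pairing l)) j (pairing l) k (a k) =
        pairing l (a i) * pairing l (a j) * ∏ k ∈ (Finset.univ.erase i).erase j, O k (a k) :=
    prod_update_update hij (fun k f => f (a k)) O (pairing l) (pairing l)
  simp only [expval_embed_mulVec hij]
  rw [integral_finsetSum _ fun a _ => ((integrable_finsetSum _ fun b _ =>
    (hint _ _).const_mul _).mul_const _).const_mul _]
  simp only [expval, Finset.mul_sum, hprod]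
  rw [Finset.sum_comm]
  refine Finset.sum_congr rfl fun a _ => ?_
  rw [integral_const_mul, integral_mul_const,
    integral_finsetSum _ fun b _ => (hint _ _).const_mul _]
  simp only [integral_const_mul, hμ.integral_momentMat_mul_mul hA hB,
    sum_mul_weingartenMat_quadZip, Finset.sum_mul, Finset.mul_sum]
  exact Finset.sum_congr rfl fun l _ => by ring

end OneGate

/-! ### Expectations over finite distributions -/

section Expectation

variable {α β : Type*} [Fintype α]

/-- The expectation of a complex function on a finite type. -/
def expect (P : PMF α) (f : α → ℂ) : ℂ := ∑ a, ((P a).toReal : ℂ) * f a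

lemma expect_pure (a : α) (f : α → ℂ) : expect (PMF.pure a) f = f a := by
  classical
  rw [expect, Finset.sum_eq_single a (fun b _ hb => by simp [hb]) (by simp)]
  simp

lemma expect_mul_left (P : PMF α) (c : ℂ) (f : α → ℂ) :
    (expect P fun a => c * f a) = c * expect P f := by
  simp only [expect, Finset.mul_sum, mul_left_comm]

lemma expect_sum {κ : Type*} (s : Finset κ) (P : PMF α) (f : κ → α → ℂ) :
    (expect P fun a => ∑ i ∈ s, f i a) = ∑ i ∈ s, expect P (f i) := by
  simp only [expect, Finset.mul_sum]
  exact Finset.sum_comm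

lemma toReal_bind_apply (P : PMF α) (K : α → PMF β) (b : β) :
    ((P.bind K) b).toReal = ∑ a, (P a).toReal * (K a b).toReal := by
  simp only [PMF.bind_apply, tsum_fintype, ← ENNReal.toReal_mul]
  exact ENNReal.toReal_sum fun a _ => ENNReal.mul_ne_top (P.apply_ne_top a) ((K a).apply_ne_top b)

variable [Fintype β]

lemma expect_bind (P : PMF α) (K : α → PMF β) (f : β → ℂ) :
    expect (P.bind K) f = expect P fun a => expect (K a) f := by
  simp only [expect, toReal_bind_apply, Complex.ofReal_sum, Complex.ofReal_mul, Finset.sum_mul,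
    Finset.mul_sum, mul_assoc]
  exact Finset.sum_comm

lemma expect_map (P : PMF α) (g : α → β) (f : β → ℂ) :
    expect (P.map g) f = expect P fun a => f (g a) := by
  simp only [PMF.map, expect_bind, Function.comp_apply, expect_pure]

lemma expect_coin {r : ℝ} (h0 : 0 ≤ r) (h1 : r ≤ 1) (f : Bool → ℂ) :
    expect (coin r) f = r * f true + (1 - r) * f false := by
  simp [expect, coin, h0, h1]

variable {κ : Type*} [Fintype κ] [DecidableEq κ]

lemma sum_pmf_apply (P : PMF α) : ∑ a, P a = 1 := by
  rw [← P.tsum_coe, tsum_fintype]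

/-- The joint law of independent random variables with laws `P k`. -/
def productPMF (P : κ → PMF α) : PMF (κ → α) :=
  PMF.ofFintype (fun γ => ∏ k, P k (γ k)) (by
    simp only [← Fintype.prod_sum, sum_pmf_apply, Finset.prod_const_one])

lemma productPMF_apply (P : κ → PMF α) (γ : κ → α) : productPMF P γ = ∏ k, P k (γ k) := rfl

lemma expect_productPMF (P : κ → PMF α) (f : κ → α → ℂ) :
    (expect (productPMF P) fun γ => ∏ k, f k (γ k)) = ∏ k, expect (P k) (f k) := by
  simp only [expect, productPMF_apply, ENNReal.toReal_prod, Complex.ofReal_prod,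
    ← Finset.prod_mul_distrib]
  exact (Fintype.prod_sum fun k a => ((P k a).toReal : ℂ) * f k a).symm

lemma productPMF_pure (γ : κ → α) : (productPMF fun k => PMF.pure (γ k)) = PMF.pure γ := by
  classical
  ext η
  simp only [productPMF_apply, PMF.pure_apply, Finset.prod_ite_zero, Finset.prod_const_one,
    Finset.mem_univ, true_imp_iff, funext_iff]

lemma map_update_apply {δ : Type*} [DecidableEq δ] (Q : PMF δ) (γ η : κ → δ) (i : κ) :
    Q.map (update γ i) η = ∏ k, if k = i then Q (η i) else if γ k = η k then 1 else 0 := by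
  rw [PMF.map_apply, ← Finset.mul_prod_erase _ _ (Finset.mem_univ i), if_pos rfl,
    Finset.prod_congr rfl fun k hk => if_neg (Finset.ne_of_mem_erase hk), Finset.prod_ite_zero,
    Finset.prod_const_one, tsum_eq_single (η i)]
  · simp [Function.eq_update_iff, eq_comm]
  · intro a ha
    rw [if_neg]
    rintro rfl
    simp at ha

lemma productPMF_bind_map_update (P : κ → PMF α) (i : κ) (Q : PMF α) :
    ((productPMF P).bind fun γ => Q.map (update γ i)) = productPMF (update P i Q) := by
  classical
  ext η
  simp only [PMF.bind_apply, tsum_fintype, productPMF_apply, map_update_apply,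
    ← Finset.prod_mul_distrib]
  rw [← Fintype.prod_sum fun k a =>
    P k a * if k = i then Q (η i) else if a = η k then 1 else 0]
  refine Finset.prod_congr rfl fun k _ => ?_
  by_cases hk : k = i
  · subst hk
    simp only [if_true, ← Finset.sum_mul, sum_pmf_apply, one_mul, update_self]
  · simp [hk]

end Expectation

/-! ### The walk as the dual of the averaged circuit -/

section Walk

variable {n q p m : ℕ}

/-- The value of a single-site functional on the normalized pairing with a given label. -/
def siteValue (b : Bool) (O : Quad (Fin q) → ℂ) : ℂ :=
  (pairing b ⬝ᵥ O) / (q : ℂ) ^ (if b then 1 else 2)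

lemma siteValue_pairing (hq : q ≠ 0) (b l : Bool) :
    siteValue b (pairing l : Quad (Fin q) → ℂ) =
      if l then (if b then (q : ℂ) else 1 / q) else 1 := by
  have hq0 : (q : ℂ) ≠ 0 := Nat.cast_ne_zero.mpr hq
  cases b <;> cases l <;> simp [siteValue, pairing_dotProduct_pairing, hq0] <;> field_simp

/-- A gate redistributes the labels of its two sites exactly as one step of the walk does. -/
lemma sum_gateCoeff_mul_siteValue (hq : 2 ≤ q) (b b' : Bool) (O₁ O₂ : Quad (Fin q) → ℂ) :
    ∑ l, gateCoeff l O₁ O₂ * (siteValue b (pairing l : Quad (Fin q) → ℂ) *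
        siteValue b' (pairing l : Quad (Fin q) → ℂ)) =
      if b = b' then siteValue b O₁ * siteValue b' O₂
      else 1 / ((q : ℂ) ^ 2 + 1) * (siteValue true O₁ * siteValue true O₂) +
        (1 - 1 / ((q : ℂ) ^ 2 + 1)) * (siteValue false O₁ * siteValue false O₂) := by
  have hq0 : (q : ℂ) ≠ 0 := by exact_mod_cast (by omega : q ≠ 0)
  have hq_add : (q : ℂ) ^ 2 + 1 ≠ 0 := by exact_mod_cast (by positivity : q ^ 2 + 1 ≠ 0)
  have hq_sub : (q : ℂ) ^ 2 - 1 ≠ 0 := by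
    rw [sub_ne_zero]
    exact_mod_cast (by nlinarith : 1 < q ^ 2).ne'
  have hfactor : ((q : ℂ) ^ 2) ^ 2 - 1 = (q ^ 2 - 1) * (q ^ 2 + 1) := by ring
  simp only [siteValue_pairing (by omega : q ≠ 0), gateCoeff, Fintype.sum_bool, wg, hfactor]
  simp only [siteValue]
  cases b <;> cases b' <;> simp <;> field_simp <;> ring

/-- The functionals whose value on `|0⟩⟨0|` is their expectation over the initial label. -/
def IsInitial [NeZero q] (O : Quad (Fin q) → ℂ) : Prop :=
  O (0, 0, 0, 0) = expect (coin (1 / ((q : ℝ) + 1))) fun b => siteValue b O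

lemma isInitial_pairing [NeZero q] (l : Bool) : IsInitial (pairing l : Quad (Fin q) → ℂ) := by
  have hq0 : (q : ℂ) ≠ 0 := NeZero.ne _
  have hq1 : (q : ℂ) + 1 ≠ 0 := by exact_mod_cast q.succ_ne_zero
  rw [IsInitial, expect_coin (by positivity) (div_le_one_of_le₀ (by linarith) (by positivity))]
  simp only [siteValue_pairing (NeZero.ne q)]
  cases l with
  | false => simp [pairing]
  | true =>
    simp only [pairing, if_true, Bool.false_eq_true, if_false, mul_one, Complex.ofReal_div,
      Complex.ofReal_one, Complex.ofReal_add, Complex.ofReal_natCast]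
    field_simp
    ring

lemma expect_initConfig (f : Fin n → Bool → ℂ) :
    (expect (initConfig n q) fun γ => ∏ k, f k (γ k)) =
      ∏ k, expect (coin (1 / ((q : ℝ) + 1))) (f k) :=
  expect_productPMF _ f

lemma expect_gateStep (hq : 2 ≤ q) {i j : Fin n} (hij : i ≠ j) (γ : Config n)
    (O : Fin n → Quad (Fin q) → ℂ) :
    (expect (gateStep q i j γ) fun γ' => ∏ k, siteValue (γ' k) (O k)) =
      ∑ l, gateCoeff l (O i) (O j) *
        ∏ k, siteValue (γ k) (update (update O i (pairing l)) j (pairing l) k) := by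
  simp only [prod_update_update hij (fun k => siteValue (γ k)), ← mul_assoc, ← Finset.sum_mul]
  simp only [mul_assoc (gateCoeff _ _ _), sum_gateCoeff_mul_siteValue hq]
  by_cases h : γ i = γ j
  · rw [gateStep, if_pos h, if_pos h, expect_pure, prod_eq_mul_mul_prod_erase hij]
  · rw [gateStep, if_neg h, if_neg h, expect_map,
      expect_coin (by positivity) (div_le_one_of_le₀ (by nlinarith) (by positivity))]
    simp only [prod_update_update hij (fun k b => siteValue b (O k))]
    push_cast
    ring

/-- The law of the configuration of the walk after a sequence of blocks. -/
def walk (blk : Fin m → Block n q p) : PMF (Config n) :=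
  (List.finRange m).foldl
    (fun P t => P.bind (gateStep q (blk t).fst (blk t).snd)) (initConfig n q)

lemma walk_succ (blk : Fin (m + 1) → Block n q p) :
    walk blk = (walk fun t => blk t.castSucc).bind
      (gateStep q (blk (Fin.last m)).fst (blk (Fin.last m)).snd) := by
  simp [walk, List.finRange_succ_last, List.foldl_map]

lemma expect_walk_succ (hq : 2 ≤ q) (blk : Fin (m + 1) → Block n q p)
    (O : Fin n → Quad (Fin q) → ℂ) :
    (expect (walk blk) fun γ => ∏ k, siteValue (γ k) (O k)) =
      ∑ l, gateCoeff l (O (blk (Fin.last m)).fst) (O (blk (Fin.last m)).snd) *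
        expect (walk fun t => blk t.castSucc) fun γ => ∏ k, siteValue (γ k)
          (update (update O (blk (Fin.last m)).fst (pairing l)) (blk (Fin.last m)).snd
            (pairing l) k) := by
  simp only [walk_succ, expect_bind, expect_gateStep hq (blk (Fin.last m)).ne, expect_sum,
    expect_mul_left]

end Walk

/-! ### Averaging the whole circuit -/

section Gates

variable {n q p : ℕ}

section Unitary

variable {ι : Type} [Fintype ι] [DecidableEq ι]

instance : SecondCountableTopology (Matrix.unitaryGroup ι ℂ) := by
  have : SecondCountableTopology (Matrix ι ι ℂ) :=
    inferInstanceAs (SecondCountableTopology (ι → ι → ℂ))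
  exact TopologicalSpace.Subtype.secondCountableTopology _

lemma exp_smul_mem_unitaryGroup {A : Matrix ι ι ℂ} (hA : A.IsHermitian) (t : ℝ) :
    NormedSpace.exp ((-Complex.I * (t : ℂ)) • A) ∈ Matrix.unitaryGroup ι ℂ := by
  have h : ((-Complex.I * (t : ℂ)) • A).conjTranspose = -((-Complex.I * (t : ℂ)) • A) := by
    rw [Matrix.conjTranspose_smul, hA.eq, ← neg_smul]
    simp
  rw [Matrix.mem_unitaryGroup_iff, Matrix.star_eq_conjTranspose, ← Matrix.exp_conjTranspose, h,
    ← Matrix.exp_add_of_commute _ _ (Commute.refl (_ • A)).neg_right, add_neg_cancel,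
    NormedSpace.exp_zero]

lemma continuous_exp_matrix : Continuous (NormedSpace.exp : Matrix ι ι ℂ → Matrix ι ι ℂ) := by
  let _ : NormedRing (Matrix ι ι ℂ) := Matrix.linftyOpNormedRing
  let _ : NormedAlgebra ℚ (Matrix ι ι ℂ) := Matrix.linftyOpNormedAlgebra
  let _ : NormedAlgebra ℂ (Matrix ι ι ℂ) := Matrix.linftyOpNormedAlgebra
  have := FiniteDimensional.complete ℂ (Matrix ι ι ℂ)
  exact NormedSpace.exp_continuous

end Unitary

lemma ParamGate.mat_mem (g : ParamGate q p) (θ : Fin p → ℝ) :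
    g.mat θ ∈ Matrix.unitaryGroup (Fin q × Fin q) ℂ :=
  mul_mem (mul_mem g.left.2 (exp_smul_mem_unitaryGroup g.isHermitian _)) g.right.2

lemma ParamGate.continuous_mat (g : ParamGate q p) : Continuous g.mat := by
  refine (continuous_const.mul (continuous_exp_matrix.comp ?_)).mul continuous_const
  exact (continuous_const.mul (Complex.continuous_ofReal.comp (continuous_apply _))).smul
    continuous_const

lemma seqMat_append_singleton (l : List (ParamGate q p)) (g : ParamGate q p) (θ : Fin p → ℝ) :
    seqMat (l ++ [g]) θ = g.mat θ * seqMat l θ := by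
  rw [seqMat, List.foldl_append]
  rfl

lemma seqMat_mem (l : List (ParamGate q p)) (θ : Fin p → ℝ) :
    seqMat l θ ∈ Matrix.unitaryGroup (Fin q × Fin q) ℂ := by
  induction l using List.reverseRecOn with
  | nil => exact one_mem _
  | append_singleton l g ih => exact seqMat_append_singleton l g θ ▸ mul_mem (g.mat_mem θ) ih

lemma continuous_seqMat (l : List (ParamGate q p)) : Continuous (seqMat l) := by
  induction l using List.reverseRecOn with
  | nil => exact continuous_const
  | append_singleton l g ih =>
    simp only [funext (seqMat_append_singleton l g)]
    exact g.continuous_mat.mul ih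

lemma continuous_embed (i j : Fin n) : Continuous (embed (q := q) i j) := by
  refine continuous_matrix fun x y => ?_
  simp only [embed]
  split_ifs
  · exact continuous_id.matrix_elem _ _
  · exact continuous_const

lemma integral_pi_eq_integral_snoc {X E : Type*} [MeasurableSpace X] [NormedAddCommGroup E]
    [NormedSpace ℝ E] {m : ℕ} (μ : Fin (m + 1) → Measure X) [∀ t, SigmaFinite (μ t)]
    {F : (Fin (m + 1) → X) → E} (hF : Integrable F (Measure.pi μ)) :
    ∫ x, F x ∂(Measure.pi μ) =
      ∫ x : Fin m → X, ∫ y, F (Fin.snoc x y) ∂(μ (Fin.last m))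
        ∂(Measure.pi fun t => μ t.castSucc) := by
  have hmp := (measurePreserving_piFinSuccAbove μ (Fin.last m)).symm
  have he (z : X × (Fin m → X)) :
      (MeasurableEquiv.piFinSuccAbove (fun _ => X) (Fin.last m)).symm z =
        (Fin.snoc z.2 z.1 : Fin (m + 1) → X) := Fin.insertNth_last' _ _
  have hFe := (hmp.integrable_comp_emb (MeasurableEquiv.measurableEmbedding _)).mpr hF
  rw [← hmp.integral_comp']
  refine (integral_prod_symm _ hFe).trans ?_
  simp only [Function.comp_apply, he, Fin.succAbove_last]

variable [NeZero q]

/-- The state prepared by a sequence of blocks from `|0ⁿ⟩`. -/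
def finalState {m : ℕ} (blk : Fin m → Block n q p) (V : Realization q m) (θ : Fin p → ℝ) :
    (Fin n → Fin q) → ℂ :=
  (List.finRange m).foldl (fun ψ t => embed (blk t).fst (blk t).snd
    (seqMat (blk t).post θ * (V t : TwoSiteOp q) * seqMat (blk t).pre θ) *ᵥ ψ)
    (Pi.single (fun _ => 0) 1)

lemma finalState_succ {m : ℕ} (blk : Fin (m + 1) → Block n q p) (V : Realization q (m + 1))
    (θ : Fin p → ℝ) :
    finalState blk V θ = embed (blk (Fin.last m)).fst (blk (Fin.last m)).snd
      (seqMat (blk (Fin.last m)).post θ * (V (Fin.last m) : TwoSiteOp q) *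
        seqMat (blk (Fin.last m)).pre θ) *ᵥ
      finalState (fun t => blk t.castSucc) (fun t => V t.castSucc) θ := by
  simp [finalState, List.finRange_succ_last, List.foldl_map]

lemma continuous_finalState {X : Type*} [TopologicalSpace X] {m : ℕ}
    (blk : Fin m → Block n q p) {V : X → Realization q m} {θ : X → Fin p → ℝ}
    (hV : Continuous V) (hθ : Continuous θ) : Continuous fun z => finalState blk (V z) (θ z) := by
  induction m with
  | zero => exact continuous_const
  | succ m ih =>
    have hpost := continuous_seqMat (blk (Fin.last m)).post
    have hpre := continuous_seqMat (blk (Fin.last m)).pre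
    have hgate : Continuous fun z => seqMat (blk (Fin.last m)).post (θ z) *
        (V z (Fin.last m) : TwoSiteOp q) * seqMat (blk (Fin.last m)).pre (θ z) := by fun_prop
    have hinit : Continuous fun z => (fun t => V z t.castSucc : Realization q m) := by fun_prop
    simp only [finalState_succ]
    exact ((continuous_embed _ _).comp hgate).matrix_mulVec (ih (fun t => blk t.castSucc) hinit)

lemma integrable_expval_finalState {m : ℕ} (blk : Fin m → Block n q p) (θ : Fin p → ℝ)
    (O : Fin n → Quad (Fin q) → ℂ) (ν : Measure (Realization q m)) [IsFiniteMeasure ν] :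
    Integrable (fun V => expval (finalState blk V θ) O) ν :=
  integrable_of_continuous
    (continuous_expval (continuous_finalState blk continuous_id continuous_const) O) ν

lemma expval_single (O : Fin n → Quad (Fin q) → ℂ) :
    expval (Pi.single (fun _ => 0) 1) O = ∏ k, O k (0, 0, 0, 0) := by
  rw [expval, Finset.sum_eq_single fun _ => (0, 0, 0, 0)]
  · simp [copies]
  · intro a _ ha
    suffices copies (Pi.single (fun _ => 0) (1 : ℂ)) a = 0 by rw [this, zero_mul]
    contrapose! ha
    simp only [copies, Pi.single_apply, ne_eq] at ha
    simp only [funext_iff, Prod.ext_iff] at ha ⊢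
    aesop
  · simp

lemma integral_expval_finalState_succ (hq : 2 ≤ q) {m : ℕ} (blk : Fin (m + 1) → Block n q p)
    (θ : Fin p → ℝ) {μ : Fin (m + 1) → Measure (Matrix.unitaryGroup (Fin q × Fin q) ℂ)}
    (hμ : ∀ t, IsTwoDesign (μ t)) (O : Fin n → Quad (Fin q) → ℂ) :
    ∫ V, expval (finalState blk V θ) O ∂(Measure.pi μ) =
      ∑ l, gateCoeff l (O (blk (Fin.last m)).fst) (O (blk (Fin.last m)).snd) *
        ∫ V, expval (finalState (fun t => blk t.castSucc) V θ)
          (update (update O (blk (Fin.last m)).fst (pairing l)) (blk (Fin.last m)).snd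
            (pairing l)) ∂(Measure.pi fun t => μ t.castSucc) := by
  have (t : Fin (m + 1)) := (hμ t).1
  rw [integral_pi_eq_integral_snoc μ (integrable_expval_finalState blk θ O _)]
  simp only [finalState_succ, Fin.snoc_last, Fin.snoc_castSucc,
    (hμ (Fin.last m)).integral_expval_embed (blk (Fin.last m)).ne hq (seqMat_mem _ _)
      (seqMat_mem _ _)]
  rw [integral_finsetSum _ fun l _ => (integrable_expval_finalState _ θ _ _).const_mul _]
  simp only [integral_const_mul]

/-- Sites not yet acted on must carry a functional for which the random initial label is right;
the pairings, which replace the functionals of the sites of a gate, always qualify. -/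
theorem integral_expval_finalState (hq : 2 ≤ q) {m : ℕ} (blk : Fin m → Block n q p)
    (θ : Fin p → ℝ) {μ : Fin m → Measure (Matrix.unitaryGroup (Fin q × Fin q) ℂ)}
    (hμ : ∀ t, IsTwoDesign (μ t)) (O : Fin n → Quad (Fin q) → ℂ)
    (hO : ∀ k, (∃ t, k = (blk t).fst ∨ k = (blk t).snd) ∨ IsInitial (O k)) :
    ∫ V, expval (finalState blk V θ) O ∂(Measure.pi μ) =
      expect (walk blk) fun γ => ∏ k, siteValue (γ k) (O k) := by
  induction m generalizing O with
  | zero =>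
    have (t : Fin 0) := (hμ t).1
    have hinit (k : Fin n) : O k (0, 0, 0, 0) = _ := (hO k).resolve_left fun ⟨t, _⟩ => t.elim0
    have hstate (V : Realization q 0) : finalState blk V θ = Pi.single (fun _ => 0) 1 := rfl
    simp only [hstate, expval_single, integral_const, probReal_univ, one_smul, hinit]
    exact (expect_initConfig fun k b => siteValue b (O k)).symm
  | succ m ih =>
    rw [integral_expval_finalState_succ hq blk θ hμ, expect_walk_succ hq]
    refine Finset.sum_congr rfl fun l _ => ?_
    rw [ih _ fun t => hμ _]
    intro k
    by_cases hsnd : k = (blk (Fin.last m)).snd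
    · subst hsnd
      exact .inr (by rw [update_self]; exact isInitial_pairing l)
    by_cases hfst : k = (blk (Fin.last m)).fst
    · subst hfst
      exact .inr (by rw [update_of_ne hsnd, update_self]; exact isInitial_pairing l)
    rw [update_of_ne hsnd, update_of_ne hfst]
    refine (hO k).imp_left fun ⟨t, ht⟩ => ?_
    induction t using Fin.lastCases with
    | last => exact absurd ht (not_or.mpr ⟨hfst, hsnd⟩)
    | cast t => exact ⟨t, ht⟩

end Gates

/-! ### The second moment of the objective -/

section Objective

variable {n q m p : ℕ}

/-- Transposes a family of fourfold indices into a fourfold index of families. -/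
def quadPi {κ : Type} : (Fin n → Quad κ) ≃ Quad (Fin n → κ) where
  toFun a := (fun k => (a k).1, fun k => (a k).2.1, fun k => (a k).2.2.1, fun k => (a k).2.2.2)
  invFun b := fun k => (b.1 k, b.2.1 k, b.2.2.1 k, b.2.2.2 k)
  left_inv _ := rfl
  right_inv _ := rfl

/-- The single-site functional whose products over the sites turn `ψ ⊗ ψ ⊗ ψ̄ ⊗ ψ̄` into
`⟨ψ, A ψ⟩` times the conjugate of `⟨ψ, B ψ⟩`. -/
def pairFunctional (A B : Matrix (Fin q) (Fin q) ℂ) (a : Quad (Fin q)) : ℂ :=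
  A a.2.2.1 a.1 * star (B a.2.1 a.2.2.2)

lemma expval_pairFunctional (ψ : (Fin n → Fin q) → ℂ)
    (A B : Fin n → Matrix (Fin q) (Fin q) ℂ) :
    expval ψ (fun k => pairFunctional (A k) (B k)) =
      (star ψ ⬝ᵥ ((Matrix.of fun a b => ∏ k, A k (a k) (b k)) *ᵥ ψ)) *
        star (star ψ ⬝ᵥ ((Matrix.of fun a b => ∏ k, B k (a k) (b k)) *ᵥ ψ)) := by
  have hform (A : QuditOp n q) :
      star ψ ⬝ᵥ (A *ᵥ ψ) = ∑ a, ∑ b, star (ψ a) * (A a b * ψ b) := by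
    simp [dotProduct, Matrix.mulVec, Finset.mul_sum]
  have hterm (b : Quad (Fin n → Fin q)) : copies ψ (quadPi.symm b) *
      ∏ k, pairFunctional (A k) (B k) (quadPi.symm b k) =
      (star (ψ b.2.2.1) * ((∏ k, A k (b.2.2.1 k) (b.1 k)) * ψ b.1)) *
        star (star (ψ b.2.1) * ((∏ k, B k (b.2.1 k) (b.2.2.2 k)) * ψ b.2.2.2)) := by
    simp only [copies, pairFunctional, quadPi, Equiv.coe_fn_symm_mk, Finset.prod_mul_distrib,
      star_mul', star_prod, star_star]
    ring
  rw [expval, ← Equiv.sum_comp quadPi.symm]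
  simp only [hterm, hform, star_sum, Matrix.of_apply]
  rw [Finset.sum_comm (f := fun a b => star (ψ a) * ((∏ k, A k (a k) (b k)) * ψ b))]
  simp only [Fintype.sum_prod_type, ← Finset.mul_sum, ← Finset.sum_mul]

lemma pairing_false_dotProduct_pairFunctional (A B : Matrix (Fin q) (Fin q) ℂ) :
    pairing false ⬝ᵥ pairFunctional A B = A.trace * star B.trace := by
  simp only [dotProduct, pairing, pairFunctional, Fintype.sum_prod_type, Matrix.trace,
    Matrix.diag, star_sum, Finset.sum_mul_sum]
  simp

lemma pairing_true_dotProduct_pairFunctional (A B : Matrix (Fin q) (Fin q) ℂ) :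
    pairing true ⬝ᵥ pairFunctional A B = (Bᴴ * A).trace := by
  simp only [dotProduct, pairing, pairFunctional, Fintype.sum_prod_type, Matrix.trace,
    Matrix.diag, Matrix.mul_apply, Matrix.conjTranspose_apply]
  simp [mul_comm]

lemma ofReal_re_dotProduct_mulVec_sq {H : QuditOp n q} (hH : H.IsHermitian)
    (ψ : (Fin n → Fin q) → ℂ) : (((star ψ ⬝ᵥ (H *ᵥ ψ)).re ^ 2 : ℝ) : ℂ) =
      (star ψ ⬝ᵥ (H *ᵥ ψ)) * star (star ψ ⬝ᵥ (H *ᵥ ψ)) := by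
  have hreal : star (star ψ ⬝ᵥ (H *ᵥ ψ)) = star ψ ⬝ᵥ (H *ᵥ ψ) := by
    rw [← Matrix.star_dotProduct, Matrix.star_mulVec, hH.eq, ← Matrix.dotProduct_mulVec]
  rw [hreal, Complex.ofReal_pow, Complex.conj_eq_iff_re.mp hreal, sq]

variable [NeZero q]

lemma OperatorBasis.trace_op (M : OperatorBasis q) (i : Fin (q ^ 2)) :
    (M.op i).trace = if i = 0 then (q : ℂ) else 0 := by
  simpa [M.op_zero, eq_comm] using M.trace_mul 0 i

lemma siteValue_pairFunctional (M : OperatorBasis q) (i j : Fin (q ^ 2)) (b : Bool) :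
    siteValue b (pairFunctional (M.op i) (M.op j)) =
      if i = j ∧ (i ≠ 0 → b = true) then 1 else 0 := by
  have hq0 : (q : ℂ) ≠ 0 := NeZero.ne _
  cases b with
  | false =>
    rw [siteValue, pairing_false_dotProduct_pairFunctional, M.trace_op, M.trace_op]
    by_cases hi : i = 0
    · subst hi
      by_cases hj : j = 0
      · simp [hj, hq0, ← sq]
      · simp [hj, Ne.symm hj]
    · simp [hi]
  | true =>
    rw [siteValue, pairing_true_dotProduct_pairFunctional, M.trace_mul]
    by_cases hij : i = j
    · simp [hij, hq0]
    · simp [hij, Ne.symm hij]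

lemma prod_siteValue_pairFunctional (M : OperatorBasis q) (x y : Fin n → Fin (q ^ 2))
    (γ : Config n) :
    ∏ k, siteValue (γ k) (pairFunctional (M.op (x k)) (M.op (y k))) =
      if x = y then (if ∀ k, x k ≠ 0 → γ k = true then 1 else 0) else 0 := by
  simp only [siteValue_pairFunctional, Finset.prod_ite_zero, Finset.prod_const_one,
    Finset.mem_univ, true_imp_iff, funext_iff (f := x), ite_and]

lemma Circuit.mat_mulVec (U : Circuit n q m p) (V : Realization q m) (θ : Fin p → ℝ) :
    U.mat V θ *ᵥ Pi.single (fun _ => 0) 1 = finalState U.block V θ := by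
  rw [Circuit.mat, finalState,
    ← List.foldl_hom (fun A : QuditOp n q => A *ᵥ Pi.single (fun _ => 0) (1 : ℂ))
      (g₂ := fun ψ t => U.blockMat V θ t *ᵥ ψ) (fun A t => Matrix.mulVec_mulVec _ _ _),
    Matrix.one_mulVec]
  rfl

lemma Circuit.objective_eq (U : Circuit n q m p) (H : QuditOp n q) (V : Realization q m)
    (θ : Fin p → ℝ) : U.objective H V θ =
      (star (finalState U.block V θ) ⬝ᵥ (H *ᵥ finalState U.block V θ)).re := by
  rw [Circuit.objective, ← U.mat_mulVec, Matrix.star_mulVec, ← Matrix.dotProduct_mulVec,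
    Matrix.mulVec_mulVec, Matrix.mulVec_mulVec]
  simp [mul_assoc]

lemma OperatorBasis.dotProduct_observable_mulVec (M : OperatorBasis q)
    (c : (Fin n → Fin (q ^ 2)) → ℂ) (φ ψ : (Fin n → Fin q) → ℂ) :
    φ ⬝ᵥ (M.observable c *ᵥ ψ) = ∑ x, c x * (φ ⬝ᵥ (M.string x *ᵥ ψ)) := by
  simp only [OperatorBasis.observable, Matrix.sum_mulVec, dotProduct_sum, Matrix.smul_mulVec,
    dotProduct_smul, smul_eq_mul]

lemma Circuit.objective_sq (U : Circuit n q m p) {M : OperatorBasis q}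
    {c : (Fin n → Fin (q ^ 2)) → ℂ} (hH : (M.observable c).IsHermitian) (V : Realization q m)
    (θ : Fin p → ℝ) : ((U.objective (M.observable c) V θ ^ 2 : ℝ) : ℂ) =
      ∑ x, ∑ y, c x * star (c y) *
        expval (finalState U.block V θ) fun k => pairFunctional (M.op (x k)) (M.op (y k)) := by
  rw [U.objective_eq, ofReal_re_dotProduct_mulVec_sq hH, M.dotProduct_observable_mulVec, star_sum,
    Finset.sum_mul_sum]
  refine Finset.sum_congr rfl fun x _ => Finset.sum_congr rfl fun y _ => ?_
  rw [expval_pairFunctional, star_mul', mul_mul_mul_comm]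
  rfl

lemma Circuit.continuous_objective (U : Circuit n q m p) (H : QuditOp n q) :
    Continuous fun z : Realization q m × (Fin p → ℝ) => U.objective H z.1 z.2 := by
  have hstate := continuous_finalState U.block (continuous_fst (X := Realization q m))
    (continuous_snd (Y := Fin p → ℝ))
  simp only [U.objective_eq]
  exact Complex.continuous_re.comp
    (hstate.star.dotProduct ((continuous_const (y := H)).matrix_mulVec hstate))

theorem Circuit.integral_objective_sq (U : Circuit n q m p) (hq : 2 ≤ q)
    {μ : Fin m → Measure (Matrix.unitaryGroup (Fin q × Fin q) ℂ)} (hμ : ∀ t, IsTwoDesign (μ t))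
    {M : OperatorBasis q} {c : (Fin n → Fin (q ^ 2)) → ℂ} (hH : (M.observable c).IsHermitian)
    (θ : Fin p → ℝ) :
    ((∫ V, U.objective (M.observable c) V θ ^ 2 ∂(Measure.pi μ) : ℝ) : ℂ) =
      ∑ x, (‖c x‖ ^ 2 : ℂ) * expect U.finalConfig fun γ =>
        if ∀ k, x k ≠ 0 → γ k = true then 1 else 0 := by
  have (t : Fin m) := (hμ t).1
  have hint (O : Fin n → Quad (Fin q) → ℂ) := integrable_expval_finalState U.block θ O (.pi μ)
  have hcorr (x y : Fin n → Fin (q ^ 2)) : ∫ V, expval (finalState U.block V θ)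
      (fun k => pairFunctional (M.op (x k)) (M.op (y k))) ∂(Measure.pi μ) =
      expect U.finalConfig fun γ => if x = y then
        (if ∀ k, x k ≠ 0 → γ k = true then 1 else 0) else 0 := by
    rw [integral_expval_finalState hq U.block θ hμ _ fun k => .inl (U.covers k)]
    simp only [prod_siteValue_pairFunctional]
    rfl
  rw [← integral_complex_ofReal]
  simp only [U.objective_sq hH]
  rw [integral_finsetSum _ fun x _ => integrable_finsetSum _ fun y _ => (hint _).const_mul _]
  refine Finset.sum_congr rfl fun x _ => ?_
  rw [integral_finsetSum _ fun y _ => (hint _).const_mul _]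
  simp only [integral_const_mul, hcorr]
  rw [Finset.sum_eq_single x (fun y _ hy => by simp [Ne.symm hy, expect]) (by simp)]
  simp only [if_true, Complex.star_def, Complex.mul_conj, Complex.normSq_eq_norm_sq,
    Complex.ofReal_pow]

lemma Circuit.secondMoment_eq_of_forall_integral_eq (U : Circuit n q m p)
    {μ : Fin m → Measure (Matrix.unitaryGroup (Fin q × Fin q) ℂ)} [∀ t, IsFiniteMeasure (μ t)]
    {H : QuditOp n q} {r : ℝ} (h : ∀ θ, ∫ V, U.objective H V θ ^ 2 ∂(Measure.pi μ) = r) :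
    U.secondMoment μ H = r := by
  set s : Set (Fin p → ℝ) := Set.Icc 0 fun _ => 2 * Real.pi
  have hs : volume.real s ≠ 0 := by
    rw [measureReal_def, Real.volume_Icc_pi_toReal fun _ => by positivity]
    exact Finset.prod_ne_zero_iff.mpr fun _ _ => by simp [Real.pi_ne_zero]
  have hint : Integrable (Function.uncurry fun (V : Realization q m) (θ : Fin p → ℝ) =>
      U.objective H V θ ^ 2) ((Measure.pi μ).prod (volume.restrict s)) := by
    rw [← (Measure.pi μ).restrict_univ, Measure.prod_restrict]
    exact ((U.continuous_objective H).pow 2).continuousOn.integrableOn_compact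
      (isCompact_univ.prod isCompact_Icc)
  calc U.secondMoment μ H
      = (volume.real s)⁻¹ * ∫ V, (∫ θ in s, U.objective H V θ ^ 2) ∂(Measure.pi μ) := by
        simp only [Circuit.secondMoment, setAverage_eq, smul_eq_mul, integral_const_mul, s]
    _ = (volume.real s)⁻¹ * ∫ θ in s, ∫ V, U.objective H V θ ^ 2 ∂(Measure.pi μ) := by
        rw [integral_integral_swap hint]
    _ = r := by simp only [h, setIntegral_const, smul_eq_mul, inv_mul_cancel_left₀ hs]

theorem Circuit.secondMoment_eq (U : Circuit n q m p) (hq : 2 ≤ q)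
    {μ : Fin m → Measure (Matrix.unitaryGroup (Fin q × Fin q) ℂ)} (hμ : ∀ t, IsTwoDesign (μ t))
    {M : OperatorBasis q} {c : (Fin n → Fin (q ^ 2)) → ℂ} (hH : (M.observable c).IsHermitian) :
    (U.secondMoment μ (M.observable c) : ℂ) =
      ∑ x, (‖c x‖ ^ 2 : ℂ) * expect U.finalConfig fun γ =>
        if ∀ k, x k ≠ 0 → γ k = true then 1 else 0 := by
  have (t : Fin m) := (hμ t).1
  have hθ := U.integral_objective_sq hq hμ hH
  rw [U.secondMoment_eq_of_forall_integral_eq fun θ =>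
    Complex.ofReal_injective ((hθ θ).trans (hθ 0).symm)]
  exact hθ 0

end Objective

/-! ### The sampled event -/

section Hit

variable {n q m p : ℕ}

lemma toReal_coeffPMF_apply {c : (Fin n → Fin (q ^ 2)) → ℂ} (hc : c ≠ 0)
    (x : Fin n → Fin (q ^ 2)) : (coeffPMF c hc x).toReal = ‖c x‖ ^ 2 / weight c :=
  ENNReal.toReal_ofReal (div_nonneg (by positivity) (weight_pos hc).le)

variable [NeZero q]

/-- The law of the truth value of `supp X ⊆ supp Γ^m`, with `X` and `Γ^m` independent. -/
def Circuit.hit (U : Circuit n q m p) (c : (Fin n → Fin (q ^ 2)) → ℂ) (hc : c ≠ 0) : PMF Bool :=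
  U.finalConfig.bind fun γ => (coeffPMF c hc).map fun x =>
    decide (∀ k, x k ≠ 0 → γ k = true)

lemma Circuit.sample_eq (U : Circuit n q m p) (c : (Fin n → Fin (q ^ 2)) → ℂ) (hc : c ≠ 0) :
    U.sample c hc = (U.hit c hc).map fun b => if b then 1 else 0 := by
  simp only [Circuit.sample, Circuit.hit, PMF.map_bind, PMF.map_comp, Function.comp_def,
    decide_eq_true_eq]

lemma Circuit.weight_mul_hit (U : Circuit n q m p) (hq : 2 ≤ q)
    {μ : Fin m → Measure (Matrix.unitaryGroup (Fin q × Fin q) ℂ)} (hμ : ∀ t, IsTwoDesign (μ t))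
    {M : OperatorBasis q} {c : (Fin n → Fin (q ^ 2)) → ℂ} (hc : c ≠ 0)
    (hH : (M.observable c).IsHermitian) :
    weight c * (U.hit c hc true).toReal = U.secondMoment μ (M.observable c) := by
  have hS : (weight c : ℂ) ≠ 0 := by exact_mod_cast (weight_pos hc).ne'
  have htrue : ((U.hit c hc true).toReal : ℂ) =
      expect (U.hit c hc) fun b => if b then 1 else 0 := by simp [expect]
  apply Complex.ofReal_injective
  rw [U.secondMoment_eq hq hμ hH, Complex.ofReal_mul, htrue, Circuit.hit, expect_bind]
  simp only [expect_map, ← expect_mul_left, ← expect_sum]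
  congr 1 with γ
  simp only [expect, toReal_coeffPMF_apply, decide_eq_true_eq, Complex.ofReal_div,
    Complex.ofReal_pow, ← mul_assoc, div_mul_cancel₀ _ hS]

end Hit

/-! ### Concentration of the empirical mean -/

section Concentration

open ProbabilityTheory
open scoped NNReal

lemma toMeasure_bind_map {α β γ : Type*} [Countable α] [MeasurableSpace α]
    [DiscreteMeasurableSpace α] [MeasurableSpace β] [MeasurableSpace γ] (P : PMF α) (Q : PMF β)
    {f : α → β → γ} (hf : Measurable (Function.uncurry f)) :
    (P.bind fun a => Q.map (f a)).toMeasure =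
      (P.toMeasure.prod Q.toMeasure).map (Function.uncurry f) := by
  ext s hs
  rw [PMF.toMeasure_bind_apply _ _ _ hs, Measure.map_apply hf hs, Measure.prod_apply (hf hs),
    lintegral_countable']
  refine tsum_congr fun a => ?_
  rw [PMF.toMeasure_map_apply _ _ _ hf.of_uncurry_left hs,
    P.toMeasure_apply_singleton a (measurableSet_singleton a), mul_comm]
  rfl

lemma hasSubgaussianMGF_map_iff {Ω Ω' : Type*} [MeasurableSpace Ω] [MeasurableSpace Ω']
    {ν : Measure Ω} {Y : Ω → Ω'} (hY : Measurable Y) {X : Ω' → ℝ} (hX : Measurable X) {c : ℝ≥0} :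
    HasSubgaussianMGF X c (ν.map Y) ↔ HasSubgaussianMGF (X ∘ Y) c ν := by
  rw [← HasSubgaussianMGF.id_map_iff hX.aemeasurable,
    ← HasSubgaussianMGF.id_map_iff (hX.comp hY).aemeasurable, Measure.map_map hX hY]

lemma hasSubgaussianMGF_sumIID {P : PMF ℕ} {r : ℝ} {c : ℝ≥0}
    (h : HasSubgaussianMGF (fun a : ℕ => (a : ℝ) - r) c P.toMeasure) (N : ℕ) :
    HasSubgaussianMGF (fun s : ℕ => (s : ℝ) - N * r) (N * c) (sumIID P N).toMeasure := by
  induction N with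
  | zero =>
    simp only [sumIID, PMF.toMeasure_pure, Nat.cast_zero, zero_mul, sub_zero]
    refine (HasSubgaussianMGF.fun_zero (μ := Measure.dirac (0 : ℕ))).congr ?_
    rw [Filter.EventuallyEq, ae_dirac_eq]
    simp
  | succ N ih =>
    rw [sumIID, toMeasure_bind_map _ _ (measurable_of_countable _),
      hasSubgaussianMGF_map_iff (measurable_of_countable _) (measurable_of_countable _)]
    have hfst := (hasSubgaussianMGF_map_iff (ν := (sumIID P N).toMeasure.prod P.toMeasure)
      measurable_fst (measurable_of_countable _)).mp (by simpa using ih)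
    have hsnd := (hasSubgaussianMGF_map_iff (ν := (sumIID P N).toMeasure.prod P.toMeasure)
      measurable_snd (measurable_of_countable _)).mp (by simpa using h)
    convert hfst.add_of_indepFun hsnd (indepFun_prod (X := fun s : ℕ => (s : ℝ) - N * r)
      (Y := fun a : ℕ => (a : ℝ) - r)
      (measurable_of_countable _) (measurable_of_countable _)) using 1
    · ext z
      simp only [Function.comp_apply, Function.uncurry]
      push_cast
      ring
    · push_cast
      ring

lemma hasSubgaussianMGF_map_indicator (B : PMF Bool) :
    HasSubgaussianMGF (fun a : ℕ => (a : ℝ) - (B true).toReal) (1 / 4)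
      (B.map fun b => if b then 1 else 0).toMeasure := by
  have hmean : ∫ b, (if b then 1 else 0 : ℝ) ∂B.toMeasure = (B true).toReal := by
    simp [PMF.integral_eq_sum]
  have hoeffding := hasSubgaussianMGF_of_mem_Icc (μ := B.toMeasure) (a := 0) (b := 1)
    (measurable_of_finite fun b => (if b then 1 else 0 : ℝ)).aemeasurable
    (.of_forall fun b => by cases b <;> simp)
  rw [← PMF.toMeasure_map _ _ (measurable_of_finite _),
    hasSubgaussianMGF_map_iff (measurable_of_finite _) (measurable_of_countable _)]
  rw [hmean] at hoeffding
  convert hoeffding using 1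
  · ext b
    cases b <;> simp
  · ext
    norm_num

lemma measureReal_le_abs_le {Ω : Type*} [MeasurableSpace Ω] {ν : Measure Ω} {X : Ω → ℝ}
    {c : ℝ≥0} (h : HasSubgaussianMGF X c ν) {ε : ℝ} (hε : 0 ≤ ε) :
    ν.real {ω | ε ≤ |X ω|} ≤ 2 * Real.exp (-ε ^ 2 / (2 * c)) := by
  have hsplit : {ω | ε ≤ |X ω|} = {ω | ε ≤ X ω} ∪ {ω | ε ≤ (-X) ω} := by
    ext ω
    simp [le_abs]
  rw [hsplit, two_mul]
  exact (measureReal_union_le _ _).trans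
    (add_le_add (h.measure_ge_le hε) (h.neg.measure_ge_le hε))

lemma numSamples_pos {S ε δ : ℝ} (hS : 0 < S) (hε : 0 < ε) (hδ : 0 < δ) (hδ' : δ < 2) :
    0 < numSamples S ε δ := by
  have : 0 < Real.log (2 / δ) := Real.log_pos ((one_lt_div hδ).mpr hδ')
  exact Nat.ceil_pos.mpr (by positivity)

lemma two_mul_exp_neg_numSamples_le {S ε δ : ℝ} (hS : 0 < S) (hε : 0 < ε) (hδ : 0 < δ) :
    2 * Real.exp (-(2 * numSamples S ε δ * (ε / S) ^ 2)) ≤ δ := by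
  have hlog : Real.log (2 / δ) ≤ 2 * numSamples S ε δ * (ε / S) ^ 2 := by
    calc Real.log (2 / δ)
        = 2 * ((1 / 2) * Real.log (2 / δ) * (S / ε) ^ 2) * (ε / S) ^ 2 := by field_simp
      _ ≤ 2 * numSamples S ε δ * (ε / S) ^ 2 := by
        gcongr
        exact Nat.le_ceil _
  calc 2 * Real.exp (-(2 * numSamples S ε δ * (ε / S) ^ 2))
      ≤ 2 * Real.exp (-Real.log (2 / δ)) := by gcongr
    _ = δ := by
        rw [Real.exp_neg, Real.exp_log (by positivity), inv_div, mul_div_cancel₀ _ two_ne_zero]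

theorem toOuterMeasure_empirical_mean_le (B : PMF Bool) {S ε δ : ℝ} (hS : 0 < S) (hε : 0 < ε)
    (hδ : 0 < δ) (hδ' : δ < 2) :
    (PMF.map (fun s : ℕ => S * ((numSamples S ε δ : ℕ) : ℝ)⁻¹ * (s : ℝ))
        (sumIID (B.map fun b => if b then 1 else 0) (numSamples S ε δ))).toOuterMeasure
      {y | ε < |y - S * (B true).toReal|} ≤ ENNReal.ofReal δ := by
  have hN : (0 : ℝ) < numSamples S ε δ := by exact_mod_cast numSamples_pos hS hε hδ hδ'
  have hbound := two_mul_exp_neg_numSamples_le hS hε hδ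
  set N := numSamples S ε δ
  set r := (B true).toReal
  set P := sumIID (B.map fun b => if b then 1 else 0) N
  have hevent : (fun s : ℕ => S * (N : ℝ)⁻¹ * (s : ℝ)) ⁻¹' {y | ε < |y - S * r|} ⊆
      {s : ℕ | N * (ε / S) ≤ |(s : ℝ) - N * r|} := by
    intro s hs
    have hscale : S * (N : ℝ)⁻¹ * s - S * r = S / N * (s - N * r) := by field_simp
    rw [Set.mem_preimage, Set.mem_ofPred_eq, hscale, abs_mul, abs_of_pos (by positivity),
      ← div_lt_iff₀' (by positivity), div_div_eq_mul_div] at hs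
    rw [Set.mem_ofPred_eq, ← mul_div_assoc, mul_comm]
    exact hs.le
  have htail := measureReal_le_abs_le
    (hasSubgaussianMGF_sumIID (hasSubgaussianMGF_map_indicator B) N)
    (by positivity : 0 ≤ N * (ε / S))
  have hexponent : -(N * (ε / S)) ^ 2 / (2 * ((N * (1 / 4) : ℝ≥0) : ℝ)) =
      -(2 * N * (ε / S) ^ 2) := by
    push_cast
    field_simp
    ring
  rw [hexponent] at htail
  calc _ ≤ P.toOuterMeasure {s : ℕ | N * (ε / S) ≤ |(s : ℝ) - N * r|} := by
        rw [PMF.toOuterMeasure_map_apply]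
        exact measure_mono hevent
    _ = ENNReal.ofReal (P.toMeasure.real {s : ℕ | N * (ε / S) ≤ |(s : ℝ) - N * r|}) := by
        rw [ofReal_measureReal, PMF.toMeasure_apply_eq_toOuterMeasure]
    _ ≤ ENNReal.ofReal δ := ENNReal.ofReal_le_ofReal (htail.trans hbound)

variable {n q m p : ℕ} [NeZero q]

lemma Circuit.estimator_eq (U : Circuit n q m p) (c : (Fin n → Fin (q ^ 2)) → ℂ) (hc : c ≠ 0)
    (N : ℕ) : U.estimator c hc N =
      PMF.map (fun s : ℕ => weight c * (N : ℝ)⁻¹ * (s : ℝ)) (sumIID (U.sample c hc) N) := by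
  unfold Circuit.estimator
  change PMF.map _ (PMF.map (fun s : ℕ => (s : ℝ)) _) = _
  rw [PMF.map_comp]
  rfl

theorem Circuit.toOuterMeasure_estimator_le (U : Circuit n q m p) (hq : 2 ≤ q)
    {μ : Fin m → Measure (Matrix.unitaryGroup (Fin q × Fin q) ℂ)} (hμ : ∀ t, IsTwoDesign (μ t))
    {M : OperatorBasis q} {c : (Fin n → Fin (q ^ 2)) → ℂ} (hc : c ≠ 0)
    (hH : (M.observable c).IsHermitian) {ε δ : ℝ} (hε : 0 < ε) (hδ : 0 < δ) (hδ' : δ < 2) :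
    (U.estimator c hc (numSamples (weight c) ε δ)).toOuterMeasure
      {y | ε < |y - U.secondMoment μ (M.observable c)|} ≤ ENNReal.ofReal δ := by
  rw [U.estimator_eq, U.sample_eq, ← U.weight_mul_hit hq hμ hc hH]
  exact toOuterMeasure_empirical_mean_le (U.hit c hc) (weight_pos hc) hε hδ hδ'

end Concentration

/-! ### Couplings -/

section Coupling

variable {α β γ δ : Type*}

/-- The laws `P` and `Q` have a coupling supported in the relation `R`. -/
def Couples (P : PMF α) (Q : PMF β) (R : α → β → Prop) : Prop :=
  ∃ J : PMF (α × β), J.map Prod.fst = P ∧ J.map Prod.snd = Q ∧ ∀ z ∈ J.support, R z.1 z.2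

lemma bind_congr_of_mem_support {P : PMF α} {f g : α → PMF β} (h : ∀ a ∈ P.support, f a = g a) :
    P.bind f = P.bind g := by
  rw [← PMF.bindOnSupport_eq_bind, ← PMF.bindOnSupport_eq_bind]
  congr 1
  funext a ha
  exact h a ha

lemma map_bindOnSupport (P : PMF α) (f : ∀ a ∈ P.support, PMF β) (g : β → γ) :
    (P.bindOnSupport f).map g = P.bindOnSupport fun a ha => (f a ha).map g := by
  simp only [PMF.map, ← PMF.bindOnSupport_eq_bind, PMF.bindOnSupport_bindOnSupport]

namespace Couples

variable {P : PMF α} {Q : PMF β} {R : α → β → Prop}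

lemma map_self (P : PMF α) {f : α → β} {R : β → α → Prop} (h : ∀ a, R (f a) a) :
    Couples (P.map f) P R := by
  refine ⟨P.map fun a => (f a, a), PMF.map_comp _ _ _, ?_, fun z hz => ?_⟩
  · exact (PMF.map_comp _ _ _).trans P.map_id
  · obtain ⟨a, -, rfl⟩ := (PMF.mem_support_map_iff _ _ _).mp hz
    exact h a

lemma pure {a : α} {b : β} (h : R a b) : Couples (PMF.pure a) (PMF.pure b) R := by
  refine ⟨PMF.pure (a, b), PMF.pure_map _ _, PMF.pure_map _ _, fun z hz => ?_⟩
  rwa [(PMF.mem_support_pure_iff _ _).mp hz]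

lemma mono {R' : α → β → Prop} (h : Couples P Q R) (hR : ∀ a b, R a b → R' a b) :
    Couples P Q R' :=
  let ⟨J, hfst, hsnd, hJ⟩ := h
  ⟨J, hfst, hsnd, fun z hz => hR _ _ (hJ z hz)⟩

lemma bind (h : Couples P Q R) {f : α → PMF γ} {g : β → PMF δ} {R' : γ → δ → Prop}
    (hfg : ∀ a b, R a b → Couples (f a) (g b) R') : Couples (P.bind f) (Q.bind g) R' := by
  obtain ⟨J, rfl, rfl, hJ⟩ := h
  choose K hfst hsnd hK using fun z hz => hfg _ _ (hJ z hz)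
  refine ⟨J.bindOnSupport K, ?_, ?_, fun w hw => ?_⟩
  · simp only [map_bindOnSupport, hfst, PMF.bindOnSupport_eq_bind, PMF.bind_map]
    rfl
  · simp only [map_bindOnSupport, hsnd, PMF.bindOnSupport_eq_bind, PMF.bind_map]
    rfl
  · obtain ⟨z, hz, hw⟩ := (PMF.mem_support_bindOnSupport_iff _ _).mp hw
    exact hK z hz w hw

lemma map_left (h : Couples P Q R) {f : α → γ} {R' : γ → β → Prop}
    (hf : ∀ a b, R a b → R' (f a) b) : Couples (P.map f) Q R' := by
  rw [← PMF.bind_pure Q]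
  exact h.bind fun a b hab => pure (hf a b hab)

lemma map_eq (h : Couples P Q R) {f : α → γ} {g : β → γ} (hfg : ∀ a b, R a b → f a = g b) :
    P.map f = Q.map g := by
  obtain ⟨J, rfl, rfl, hJ⟩ := h
  rw [PMF.map_comp, PMF.map_comp]
  exact bind_congr_of_mem_support fun z hz => congrArg PMF.pure (hfg _ _ (hJ z hz))

lemma exists_of_mem_support (h : Couples P Q R) {a : α} (ha : a ∈ P.support) : ∃ b, R a b := by
  obtain ⟨J, rfl, rfl, hJ⟩ := h
  obtain ⟨z, hz, rfl⟩ := (PMF.mem_support_map_iff _ _ _).mp ha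
  exact ⟨z.2, hJ z hz⟩

end Couples

end Coupling

/-! ### A probabilistic program logic with time bounds -/

section ProgramLogic

variable {L : ℕ} {D : PMF (Fin L → ℕ)} {β γ : Type*}

/-- The command `c`, started in the memory `σ`, takes at most `T` units of time, and its final
memory has a coupling with the law `Q` that is supported in `R`: the quantitative analogue of a
Hoare triple, with `R` as postcondition. -/
def Sim (D : PMF (Fin L → ℕ)) (c : Cmd) (σ : Store) (Q : PMF β) (R : Store → β → Prop)
    (T : ℕ) : Prop :=
  Couples (c.run D σ) Q fun o b => R o.1 b ∧ o.2 ≤ T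

namespace Sim

variable {c c₁ c₂ : Cmd} {σ : Store} {Q : PMF β} {R : Store → β → Prop} {T T₁ T₂ : ℕ}

lemma mono {R' : Store → β → Prop} {T' : ℕ} (h : Sim D c σ Q R T)
    (hR : ∀ σ' b, R σ' b → R' σ' b) (hT : T ≤ T') : Sim D c σ Q R' T' :=
  Couples.mono h fun _ _ ho => ⟨hR _ _ ho.1, ho.2.trans hT⟩

lemma mono_time {T' : ℕ} (h : Sim D c σ Q R T) (hT : T ≤ T') : Sim D c σ Q R T' :=
  h.mono (fun _ _ => id) hT

lemma skip {b : β} (h : R σ b) : Sim D .skip σ (PMF.pure b) R 1 :=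
  Couples.pure ⟨h, le_rfl⟩

lemma setN {b : β} {r : NReg} {e : NExpr} (h : R (σ.setN r (e.eval σ)) b) :
    Sim D (.setN r e) σ (PMF.pure b) R (e.cost + 1) :=
  Couples.pure ⟨h, le_rfl⟩

lemma seq (h₁ : Sim D c₁ σ Q R T₁) {g : β → PMF γ} {R' : Store → γ → Prop}
    (h₂ : ∀ σ' b, R σ' b → Sim D c₂ σ' (g b) R' T₂) :
    Sim D (.seq c₁ c₂) σ (Q.bind g) R' (T₁ + T₂ + 1) :=
  h₁.bind fun o b hob => (h₂ o.1 b hob.1).map_left fun _ _ ho' =>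
    ⟨ho'.1, Nat.succ_le_succ (Nat.add_le_add hob.2 ho'.2)⟩

lemma seq_skip (h : Sim D c σ Q R T) : Sim D (.seq c .skip) σ Q R (T + 2) := by
  simpa only [PMF.bind_pure] using h.seq (R' := R) fun _ _ hR => skip hR

lemma det_seq {R₁ : Store → Prop} (h₁ : Sim D c₁ σ (PMF.pure ()) (fun σ' _ => R₁ σ') T₁)
    (h₂ : ∀ σ', R₁ σ' → Sim D c₂ σ' Q R T₂) : Sim D (.seq c₁ c₂) σ Q R (T₁ + T₂ + 1) := by
  simpa only [PMF.pure_bind] using h₁.seq (g := fun _ => Q) fun σ' _ => h₂ σ'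

lemma seq_of_run_eq_pure {σ' : Store} (h₁ : c₁.run D σ = PMF.pure (σ', T₁))
    (h₂ : Sim D c₂ σ' Q R T₂) : Sim D (.seq c₁ c₂) σ Q R (T₁ + T₂ + 1) :=
  det_seq (R₁ := (· = σ')) (by rw [Sim, h₁]; exact Couples.pure ⟨rfl, le_rfl⟩)
    fun _ hσ => hσ ▸ h₂

lemma setN_seq {r : NReg} {e : NExpr} (h : Sim D c (σ.setN r (e.eval σ)) Q R T) :
    Sim D (.seq (.setN r e) c) σ Q R (e.cost + 1 + T + 1) :=
  seq_of_run_eq_pure rfl h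

lemma setR_seq {r : RReg} {e : RExpr} (h : Sim D c (σ.setR r (e.eval σ)) Q R T) :
    Sim D (.seq (.setR r e) c) σ Q R (e.cost + 1 + T + 1) :=
  seq_of_run_eq_pure rfl h

lemma ceil_seq {r : NReg} {e : RExpr} (h : Sim D c (σ.setN r ⌈e.eval σ⌉₊) Q R T) :
    Sim D (.seq (.ceil r e) c) σ Q R (e.cost + 1 + T + 1) :=
  seq_of_run_eq_pure rfl h

lemma setCell_seq {a : Arr} {e₁ e₂ : NExpr}
    (h : Sim D c (σ.setArr a (update (σ.arr a) (e₁.eval σ) (e₂.eval σ))) Q R T) :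
    Sim D (.seq (.setCell a e₁ e₂) c) σ Q R (e₁.cost + e₂.cost + 1 + T + 1) :=
  seq_of_run_eq_pure rfl h

lemma seq_of_run_eq_map {X : Type*} {P : PMF X} {f : X → Store} {g : X → PMF β}
    (h₁ : c₁.run D σ = P.map fun x => (f x, T₁)) (h₂ : ∀ x, Sim D c₂ (f x) (g x) R T₂) :
    Sim D (.seq c₁ c₂) σ (P.bind g) R (T₁ + T₂ + 1) := by
  have hsample : Sim D c₁ σ P (fun σ' x => σ' = f x) T₁ := by
    rw [Sim, h₁]
    exact Couples.map_self P fun x => ⟨rfl, le_rfl⟩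
  exact hsample.seq fun _ x hσ => hσ ▸ h₂ x

lemma flip_seq {r : NReg} {e : RExpr} {g : Bool → β}
    (h : ∀ b, Sim D c (σ.setN r (if b then 1 else 0)) (PMF.pure (g b)) R T) :
    Sim D (.seq (.flip r e) c) σ ((coin (e.eval σ)).map g) R (e.cost + 1 + T + 1) :=
  seq_of_run_eq_map rfl h

lemma draw_seq {X : Type*} {P : PMF X} {f : X → Fin L → ℕ} {a : Arr} {g : X → PMF β}
    (h : ∀ x, Sim (P.map f) c (σ.setArr a fun k => if h : k < L then f x ⟨k, h⟩ else σ.arr a k)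
      (g x) R T) :
    Sim (P.map f) (.seq (.draw a) c) σ (P.bind g) R (L + 1 + T + 1) :=
  seq_of_run_eq_map (PMF.map_comp f P _) h

lemma ifEq {e₁ e₂ : NExpr} (h₁ : e₁.eval σ = e₂.eval σ → Sim D c₁ σ Q R T)
    (h₂ : e₁.eval σ ≠ e₂.eval σ → Sim D c₂ σ Q R T) :
    Sim D (.ifEq e₁ e₂ c₁ c₂) σ Q R (T + e₁.cost + e₂.cost + 1) := by
  have hbranch : Couples (if e₁.eval σ = e₂.eval σ then c₁.run D σ else c₂.run D σ) Q
      (fun o b => R o.1 b ∧ o.2 ≤ T) := by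
    split_ifs with h
    exacts [h₁ h, h₂ h]
  exact hbranch.map_left fun _ _ ho => ⟨ho.1, by dsimp only; gcongr; exact ho.2⟩

end Sim

/-- Runs the kernels `g 0, …, g (K - 1)` one after the other, started in `b`. -/
def iterBind {K : ℕ} (g : Fin K → β → PMF β) (b : β) : PMF β :=
  (List.finRange K).foldl (fun P k => P.bind (g k)) (PMF.pure b)

lemma iterBind_succ {K : ℕ} (g : Fin (K + 1) → β → PMF β) (b : β) :
    iterBind g b = (iterBind (fun k => g k.castSucc) b).bind (g (Fin.last K)) := by
  rw [iterBind, List.finRange_succ_last, List.foldl_append, List.foldl_map]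
  rfl

lemma iterBind_pure {K : ℕ} (b : β) : iterBind (fun _ : Fin K => PMF.pure) b = PMF.pure b := by
  simp [iterBind, PMF.bind_pure]

lemma foldl_bind_eq_bind_foldl {κ : Type*} (g : κ → β → PMF β) (l : List κ) (P : PMF β) :
    l.foldl (fun P t => P.bind (g t)) P =
      P.bind fun b => l.foldl (fun P t => P.bind (g t)) (PMF.pure b) := by
  induction l using List.reverseRecOn with
  | nil => exact P.bind_pure.symm
  | append_singleton l t ih =>
    simp only [List.foldl_append, List.foldl_cons, List.foldl_nil]
    rw [ih, PMF.bind_bind]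

lemma couples_runLoop {body : Store → PMF (Store × ℕ)} {r : NReg} {σ : Store} {T K : ℕ}
    {g : Fin K → β → PMF β} {b₀ : β} (I : ℕ → Store → β → Prop) (h₀ : I 0 σ b₀)
    (hstep : ∀ (k : Fin K) (σ' b), I k σ' b →
      Couples (body (σ'.setN r k)) (g k b) fun o b' => I (k + 1) o.1 b' ∧ o.2 ≤ T) :
    Couples (runLoop body r σ K) (iterBind g b₀) fun o b => I K o.1 b ∧ o.2 ≤ K * (T + 1) := by
  induction K with
  | zero => exact Couples.pure ⟨h₀, Nat.zero_le _⟩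
  | succ K ih =>
    rw [iterBind_succ]
    refine (ih fun k => hstep k.castSucc).bind fun o b hob =>
      (hstep (Fin.last K) o.1 b hob.1).map_left fun o' b' ho' => ⟨ho'.1, ?_⟩
    rw [Nat.succ_mul]
    exact Nat.add_le_add_right (Nat.add_le_add hob.2 ho'.2) 1

lemma Sim.loop {c : Cmd} {r : NReg} {e : NExpr} {σ : Store} {T K : ℕ} (hK : e.eval σ = K)
    {g : Fin K → β → PMF β} {b₀ : β} (I : ℕ → Store → β → Prop) (h₀ : I 0 σ b₀)
    (hstep : ∀ (k : Fin K) (σ' b), I k σ' b →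
      Sim D c (σ'.setN r k) (g k b) (I (k + 1)) T) :
    Sim D (.loop r e c) σ (iterBind g b₀) (I K) (K * (T + 1) + e.cost + 1) := by
  subst hK
  exact (couples_runLoop I h₀ hstep).map_left fun _ _ ho =>
    ⟨ho.1, by dsimp only; gcongr; exact ho.2⟩

lemma Sim.loop_det {c : Cmd} {r : NReg} {e : NExpr} {σ : Store} {T K : ℕ} (hK : e.eval σ = K)
    (I : ℕ → Store → Prop) (h₀ : I 0 σ)
    (hstep : ∀ (k : Fin K) (σ'), I k σ' →
      Sim D c (σ'.setN r k) (PMF.pure ()) (fun σ'' _ => I (k + 1) σ'') T) :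
    Sim D (.loop r e c) σ (PMF.pure ()) (fun σ' _ => I K σ') (K * (T + 1) + e.cost + 1) := by
  simpa only [iterBind_pure] using Sim.loop (D := D) hK (g := fun _ => PMF.pure) (b₀ := ())
    (fun k σ' _ => I k σ') h₀ fun k σ' _ hI => hstep k σ' hI

end ProgramLogic

/-! ### Correctness and running time of the program -/

section MonteCarlo

lemma foldl_bind_map_update_productPMF {κ α : Type*} [Fintype κ] [DecidableEq κ] [Fintype α]
    (Q : PMF α) (l : List κ) (P : κ → PMF α) :
    l.foldl (fun R i => R.bind fun γ => Q.map (update γ i)) (productPMF P) =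
      productPMF fun k => if k ∈ l then Q else P k := by
  induction l generalizing P with
  | nil => simp
  | cons i l ih =>
    rw [List.foldl_cons, productPMF_bind_map_update, ih]
    congr 1
    funext k
    by_cases hk : k = i <;> simp [hk]

lemma iterBind_label_eq_initConfig (n q : ℕ) (γ : Config n) :
    iterBind (fun k γ => (coin (1 / ((q : ℝ) + 1))).map (update γ k)) γ = initConfig n q := by
  rw [iterBind, ← productPMF_pure, foldl_bind_map_update_productPMF]
  simp only [List.mem_finRange, if_true]
  rfl

lemma iterBind_add_eq_sumIID (P : PMF ℕ) (N : ℕ) :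
    iterBind (fun (_ : Fin N) s => P.map fun a => s + a) 0 = sumIID P N := by
  induction N with
  | zero => rfl
  | succ N ih => rw [iterBind_succ, ih, sumIID]

variable {n q m p : ℕ}

lemma Circuit.finalConfig_eq (U : Circuit n q m p) :
    U.finalConfig = (initConfig n q).bind
      (iterBind fun t => gateStep q (U.block t).fst (U.block t).snd) :=
  foldl_bind_eq_bind_foldl _ _ _

/-- The invariant of the main loop of the program: the registers and arrays that a round only
reads, and the value of the counter of successes. -/
structure RoundInvariant (U : Circuit n q m p) (S : ℝ) (N count : ℕ) (σ : Store) : Prop where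
  nat_n : σ.nat .n = n
  nat_m : σ.nat .m = m
  nat_N : σ.nat .N = N
  nat_count : σ.nat .count = count
  real_S : σ.real .S = S
  real_p0 : σ.real .p0 = 1 / ((q : ℝ) + 1)
  real_p1 : σ.real .p1 = 1 / ((q : ℝ) ^ 2 + 1)
  gateFst : ∀ t : Fin m, σ.arr .gateFst t = (U.block t).fst
  gateSnd : ∀ t : Fin m, σ.arr .gateSnd t = (U.block t).snd

namespace RoundInvariant

variable {U : Circuit n q m p} {S : ℝ} {N count : ℕ} {σ : Store}

lemma setN (h : RoundInvariant U S N count σ) {r : NReg} (hr : r ∉ [.n, .m, .N, .count]) (k : ℕ) :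
    RoundInvariant U S N count (σ.setN r k) := by
  simp only [List.mem_cons, List.not_mem_nil, or_false, not_or, ne_comm (a := r)] at hr
  obtain ⟨hn, hm, hN, hcount⟩ := hr
  exact { h with
    nat_n := (update_of_ne hn _ _).trans h.nat_n
    nat_m := (update_of_ne hm _ _).trans h.nat_m
    nat_N := (update_of_ne hN _ _).trans h.nat_N
    nat_count := (update_of_ne hcount _ _).trans h.nat_count }

lemma setN_count (h : RoundInvariant U S N count σ) (k : ℕ) :
    RoundInvariant U S N k (σ.setN .count k) :=
  { h with nat_count := by simp [Store.setN] }

lemma setArr (h : RoundInvariant U S N count σ) {a : Arr} (ha : a ∉ [.gateFst, .gateSnd])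
    (f : ℕ → ℕ) : RoundInvariant U S N count (σ.setArr a f) := by
  simp only [List.mem_cons, List.not_mem_nil, or_false, not_or, ne_comm (a := a)] at ha
  exact { h with
    gateFst := fun t => (congrFun (update_of_ne ha.1 _ _) _).trans (h.gateFst t)
    gateSnd := fun t => (congrFun (update_of_ne ha.2 _ _) _).trans (h.gateSnd t) }

end RoundInvariant

/-- The array `label` agrees on the sites in `s` with the configuration `γ`, where `1` stands for
the label `S` and `0` for `I`. -/
def HasLabels (s : Set (Fin n)) (σ : Store) (γ : Config n) : Prop :=
  ∀ j ∈ s, σ.arr .label j = if γ j then 1 else 0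

lemma HasLabels.setArr_label {s : Set (Fin n)} {σ : Store} {γ : Config n} (h : HasLabels s σ γ)
    (i : Fin n) (b : Bool) :
    HasLabels (insert i s)
      (σ.setArr .label (update (σ.arr .label) i (if b then 1 else 0))) (update γ i b) := by
  intro j hj
  simp only [Store.setArr, update_self]
  by_cases hji : j = i
  · simp [hji]
  · rw [update_of_ne (Fin.val_ne_of_ne hji), update_of_ne hji]
    exact h j (hj.resolve_left hji)

variable {L : ℕ} {D : PMF (Fin L → ℕ)} {U : Circuit n q m p} {S : ℝ} {N count : ℕ} {σ : Store}
  {γ : Config n}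

/-- The body of the first loop of `simulateWalk`. -/
def labelSite : Cmd :=
  .block [.flip .b (.reg .p0), .setCell .label (.reg .s) (.reg .b)]

lemma sim_labelSite (hσ : RoundInvariant U S N count σ) (k : Fin n)
    (hγ : HasLabels {j | (j : ℕ) < k} σ γ) :
    Sim D labelSite (σ.setN .s k) ((coin (1 / ((q : ℝ) + 1))).map (update γ k))
      (fun σ' γ' => RoundInvariant U S N count σ' ∧ HasLabels {j | (j : ℕ) < k + 1} σ' γ') 8 := by
  have hsites : {j : Fin n | (j : ℕ) < k + 1} = insert k {j : Fin n | (j : ℕ) < k} := by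
    ext j
    simp [Fin.ext_iff, le_iff_eq_or_lt]
  rw [hsites, ← hσ.real_p0]
  exact Sim.flip_seq (e := .reg .p0) fun b => Sim.setCell_seq (Sim.skip
    ⟨((hσ.setN (by decide) _).setN (by decide) _).setArr (by decide) _, hγ.setArr_label k b⟩)

/-- The body of the second loop of `simulateWalk`, once the sites `u` and `v` of the gate are
known. -/
def updateLabels : Cmd :=
  .ifEq (.cell .label (.reg .u)) (.cell .label (.reg .v)) .skip (.block [
    .flip .b (.reg .p1),
    .setCell .label (.reg .u) (.reg .b),
    .setCell .label (.reg .v) (.reg .b)])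

lemma sim_updateLabels (hσ : RoundInvariant U S N count σ) (hγ : HasLabels .univ σ γ)
    {i j : Fin n} (hu : σ.nat .u = i) (hv : σ.nat .v = j) :
    Sim D updateLabels σ (gateStep q i j γ)
      (fun σ' γ' => RoundInvariant U S N count σ' ∧ HasLabels .univ σ' γ') 17 := by
  have hlabels : σ.arr .label (σ.nat .u) = σ.arr .label (σ.nat .v) ↔ γ i = γ j := by
    rw [hu, hv, hγ i trivial, hγ j trivial]
    cases γ i <;> cases γ j <;> simp
  refine Sim.ifEq (T := 12) (fun h => ?_) fun h => ?_
  · rw [gateStep, if_pos (hlabels.mp h)]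
    exact (Sim.skip ⟨hσ, hγ⟩).mono_time (by norm_num)
  · rw [gateStep, if_neg (mt hlabels.mpr h), ← hσ.real_p1]
    refine Sim.flip_seq (e := .reg .p1) fun b => Sim.setCell_seq (Sim.setCell_seq (Sim.skip
      ⟨((hσ.setN (by decide) _).setArr (by decide) _).setArr (by decide) _, ?_⟩))
    have hlabelled := (hγ.setArr_label i b).setArr_label j b
    rw [Set.insert_eq_of_mem (Set.mem_univ _), Set.insert_eq_of_mem (Set.mem_univ _), ← hu,
      ← hv] at hlabelled
    exact hlabelled

/-- The body of the second loop of `simulateWalk`. -/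
def applyGate : Cmd :=
  .block [.setN .u (.cell .gateFst (.reg .t)), .setN .v (.cell .gateSnd (.reg .t)), updateLabels]

lemma sim_applyGate (hσ : RoundInvariant U S N count σ) (hγ : HasLabels .univ σ γ) (t : Fin m) :
    Sim D applyGate (σ.setN .t t) (gateStep q (U.block t).fst (U.block t).snd γ)
      (fun σ' γ' => RoundInvariant U S N count σ' ∧ HasLabels .univ σ' γ') 27 := by
  refine Sim.setN_seq (T := 23) (Sim.setN_seq (T := 19) (Sim.seq_skip (sim_updateLabels
    (((hσ.setN ?_ _).setN ?_ _).setN ?_ _) hγ ?_ ?_)))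
  · decide
  · decide
  · decide
  · exact hσ.gateFst t
  · exact hσ.gateSnd t

lemma sim_simulateWalk (hσ : RoundInvariant U S N count σ) :
    Sim D simulateWalk σ U.finalConfig
      (fun σ' γ => RoundInvariant U S N count σ' ∧ HasLabels .univ σ' γ)
      (n * 9 + m * 28 + 8) := by
  have hinit : Sim D (.loop .s (.reg .n) labelSite) σ (initConfig n q)
      (fun σ' γ => RoundInvariant U S N count σ' ∧ HasLabels .univ σ' γ) (n * 9 + 2) := by
    rw [← iterBind_label_eq_initConfig n q fun _ => false]
    refine (Sim.loop (e := .reg .n) hσ.nat_n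
      (fun k σ' γ => RoundInvariant U S N count σ' ∧ HasLabels {j : Fin n | (j : ℕ) < k} σ' γ)
      ⟨hσ, fun j hj => absurd hj (Nat.not_lt_zero j)⟩
      fun k σ' γ h => sim_labelSite h.1 k h.2).mono ?_ le_rfl
    exact fun σ' γ h => ⟨h.1, fun j _ => h.2 j j.isLt⟩
  rw [U.finalConfig_eq]
  refine (hinit.seq (T₂ := m * 28 + 4) fun σ' γ hσ' => Sim.seq_skip
    (Sim.loop (e := .reg .m) hσ'.1.nat_m
      (fun _ σ' γ => RoundInvariant U S N count σ' ∧ HasLabels .univ σ' γ) hσ'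
      fun t σ' γ h => sim_applyGate h.1 h.2 t)).mono_time ?_
  omega

/-- The body of the loop of `testSupport`. -/
def testSite : Cmd :=
  .ifEq (.cell .X (.reg .s)) (.const 0) .skip
    (.ifEq (.cell .label (.reg .s)) (.const 1) .skip (.setN .hit (.const 0)))

lemma sim_testSite (σ : Store) :
    Sim D testSite σ (PMF.pure ()) (fun σ' _ => σ' =
      if σ.arr .X (σ.nat .s) ≠ 0 → σ.arr .label (σ.nat .s) = 1 then σ else σ.setN .hit 0) 10 := by
  refine Sim.ifEq (T := 6) (fun hX => ?_) fun hX =>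
    Sim.ifEq (T := 2) (fun hlabel => ?_) fun hlabel => ?_
  · refine Sim.mono_time (Sim.skip ?_) (by norm_num : 1 ≤ 6)
    exact (if_pos fun h => absurd hX h).symm
  · refine Sim.mono_time (Sim.skip ?_) (by norm_num : 1 ≤ 2)
    exact (if_pos fun _ => hlabel).symm
  · exact Sim.setN (if_neg fun h => hlabel (h hX)).symm

lemma sim_testSupport (hσ : RoundInvariant U S N count σ) (hγ : HasLabels .univ σ γ) [NeZero q]
    {x : Fin n → Fin (q ^ 2)} (hx : ∀ j : Fin n, σ.arr .X j = x j) :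
    Sim D testSupport σ (PMF.pure ())
      (fun σ' _ => RoundInvariant U S N count σ' ∧
        σ'.nat .hit = if ∀ k, x k ≠ 0 → γ k = true then 1 else 0) (n * 11 + 7) := by
  set I : ℕ → Store → Prop := fun k σ' =>
    RoundInvariant U S N count σ' ∧ σ'.arr = σ.arr ∧
      σ'.nat .hit = if ∀ j : Fin n, (j : ℕ) < k → x j ≠ 0 → γ j = true then 1 else 0
  have hσ₁ : RoundInvariant U S N count (σ.setN .hit 1) := hσ.setN (by decide) _
  have hinit : I 0 (σ.setN .hit 1) := ⟨hσ₁, rfl, by simp [Store.setN]⟩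
  have hstep (k : Fin n) (σ' : Store) (h : I k σ') : Sim D testSite (σ'.setN .s k)
      (PMF.pure ()) (fun σ'' _ => I (k + 1) σ'') 10 := by
    obtain ⟨hσ', harr, hhit⟩ := h
    have hsite : (σ'.arr .X k ≠ 0 → σ'.arr .label k = 1) ↔ (x k ≠ 0 → γ k = true) := by
      rw [harr, hx, hγ k trivial]
      simp
    refine (sim_testSite _).mono ?_ le_rfl
    rintro _ - rfl
    change I (k + 1) (if σ'.arr .X k ≠ 0 → σ'.arr .label k = 1 then _ else _)
    simp only [hsite, I, Nat.lt_succ_iff_lt_or_eq, or_imp, forall_and, Fin.val_inj, forall_eq]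
    have hσ'' := hσ'.setN (r := .s) (by decide) k
    by_cases hk : x k ≠ 0 → γ k = true
    · rw [if_pos hk]
      exact ⟨hσ'', harr, by simp only [and_iff_left hk]; exact hhit⟩
    · rw [if_neg hk, if_neg fun h => hk h.2]
      exact ⟨hσ''.setN (by decide) _, harr, by simp [Store.setN]⟩
  refine (Sim.setN_seq (T := n * 11 + 4) (Sim.seq_skip ((Sim.loop_det (e := .reg .n)
    hσ₁.nat_n I hinit hstep).mono ?_ le_rfl))).mono_time ?_
  · rintro σ' - ⟨hσ', -, hhit⟩
    exact ⟨hσ', by simpa only [Fin.is_lt, true_imp_iff] using hhit⟩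
  · simp only [NExpr.cost]
    omega

/-- The body of the main loop of the program. -/
def sampleRound : Cmd :=
  .block [simulateWalk, .draw .X, testSupport, .setN .count (.add (.reg .count) (.reg .hit))]

lemma sim_setup (U : Circuit n q m p) (S ε δ : ℝ) :
    Sim D setup (U.input S ε δ) (PMF.pure ())
      (fun σ' _ => RoundInvariant U S (numSamples S ε δ) 0 σ') 50 := by
  refine Sim.mono_time
    (Sim.ceil_seq (Sim.setR_seq (Sim.setR_seq (Sim.setN_seq (Sim.skip ?_))))) ?_
  · constructor <;> simp [Store.setN, Store.setR, Circuit.input, NExpr.eval, RExpr.eval,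
      numSamples, sq]
  · simp [NExpr.cost, RExpr.cost]

lemma Circuit.sites_le (U : Circuit n q m p) : n ≤ 2 * m := by
  have hcovers : Function.Surjective fun z : Fin m × Bool =>
      if z.2 then (U.block z.1).fst else (U.block z.1).snd := fun k => by
    obtain ⟨t, ht | ht⟩ := U.covers k
    exacts [⟨(t, true), ht.symm⟩, ⟨(t, false), ht.symm⟩]
  simpa [mul_comm] using Fintype.card_le_of_surjective _ hcovers

lemma numSamples_le {S ε δ : ℝ} (hε : 0 < ε) (hδ : 0 < δ) (hεS : ε ≤ S) (hδ' : δ ≤ 1 / 2) :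
    (numSamples S ε δ : ℝ) ≤ 3 * (S ^ 2 * Real.log (1 / δ) * (ε ^ 2)⁻¹) := by
  have hlog_two : 1 / 2 < Real.log 2 := by linarith [Real.log_two_gt_d9]
  have hlog_le : Real.log 2 ≤ Real.log (1 / δ) :=
    Real.log_le_log two_pos (by rw [le_div_iff₀ hδ]; linarith)
  have hlog : Real.log (2 / δ) = Real.log 2 + Real.log (1 / δ) := by
    rw [← Real.log_mul two_ne_zero (by positivity), mul_one_div]
  have hlog_nonneg : 0 ≤ Real.log (2 / δ) := by linarith
  have hratio : 1 ≤ (S / ε) ^ 2 := one_le_pow₀ ((one_le_div hε).mpr hεS)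
  calc (numSamples S ε δ : ℝ)
      ≤ 1 / 2 * Real.log (2 / δ) * (S / ε) ^ 2 + 1 :=
        (Nat.ceil_lt_add_one (by positivity)).le
    _ ≤ Real.log (1 / δ) * (S / ε) ^ 2 + 2 * (Real.log (1 / δ) * (S / ε) ^ 2) := by
        gcongr
        · linarith
        · nlinarith
    _ = 3 * (S ^ 2 * Real.log (1 / δ) * (ε ^ 2)⁻¹) := by
        rw [div_pow]
        ring

variable [NeZero q] (c : (Fin n → Fin (q ^ 2)) → ℂ) (hc : c ≠ 0)

lemma sim_sampleRound (hσ : RoundInvariant U S N count σ) :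
    Sim ((coeffPMF c hc).map fun x k => (x k : ℕ)) sampleRound σ
      ((U.sample c hc).map fun a => count + a)
      (fun σ' s => RoundInvariant U S N s σ') (n * 21 + m * 28 + 25) := by
  have hlaw : (U.sample c hc).map (fun a => count + a) = U.finalConfig.bind fun γ =>
      (coeffPMF c hc).bind fun x =>
        PMF.pure (count + if ∀ k, x k ≠ 0 → γ k = true then 1 else 0) := by
    simp only [Circuit.sample, PMF.map_bind, PMF.map_comp]
    rfl
  rw [hlaw]
  refine ((sim_simulateWalk hσ).seq (T₂ := n * 12 + 16) fun σ₁ γ hσ₁ => ?_).mono_time (by omega)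
  refine (Sim.draw_seq (T := n * 11 + 14) fun x => ?_).mono_time (by omega)
  refine Sim.det_seq (T₂ := 6) (sim_testSupport (γ := γ) (x := x)
    (hσ₁.1.setArr ?_ _) ?_ ?_) fun σ₂ hσ₂ => Sim.seq_skip (T := 4) (Sim.setN ?_)
  · decide
  · exact hσ₁.2
  · intro j
    simp [Store.setArr]
  · rw [show (NExpr.add (.reg .count) (.reg .hit)).eval σ₂ = _ from
      congrArg₂ (· + ·) hσ₂.1.nat_count hσ₂.2]
    exact hσ₂.1.setN_count _

lemma sim_monteCarlo (U : Circuit n q m p) (S ε δ : ℝ) :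
    Sim ((coeffPMF c hc).map fun x k => (x k : ℕ)) monteCarlo (U.input S ε δ)
      (sumIID (U.sample c hc) (numSamples S ε δ))
      (fun σ' s => σ'.real .out = S * ((numSamples S ε δ : ℕ) : ℝ)⁻¹ * (s : ℝ))
      (numSamples S ε δ * (n * 21 + m * 28 + 26) + 80) := by
  set N := numSamples S ε δ
  refine ((sim_setup U S ε δ).det_seq (T₂ := N * (n * 21 + m * 28 + 26) + 18)
    fun σ₁ hσ₁ => ?_).mono_time (by omega)
  rw [← PMF.bind_pure (sumIID (U.sample c hc) N), ← iterBind_add_eq_sumIID]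
  refine ((Sim.loop (e := .reg .N) hσ₁.nat_N (fun _ σ' s => RoundInvariant U S N s σ') hσ₁
    fun k σ' s hσ' => sim_sampleRound c hc (hσ'.setN (by decide) k)).seq (T₂ := 15)
    fun σ₂ s hσ₂ => ?_).mono_time le_rfl
  refine (Sim.setR_seq (Sim.skip ?_)).mono_time (by simp [NExpr.cost, RExpr.cost])
  simp [Store.setR, RExpr.eval, NExpr.eval, hσ₂.real_S, hσ₂.nat_N, hσ₂.nat_count]

theorem Circuit.map_out_runMonteCarlo (U : Circuit n q m p) (ε δ : ℝ) :
    (U.runMonteCarlo c hc ε δ).map (fun o => o.1.real RReg.out) =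
      U.estimator c hc (numSamples (weight c) ε δ) := by
  rw [U.estimator_eq]
  exact (sim_monteCarlo c hc U (weight c) ε δ).map_eq fun _ _ h => h.1

theorem Circuit.time_runMonteCarlo_le (U : Circuit n q m p) (hn : 1 ≤ n) {ε δ : ℝ} (hε : 0 < ε)
    (hδ : 0 < δ) (hδ' : δ < 2) {o : Store × ℕ} (ho : o ∈ (U.runMonteCarlo c hc ε δ).support) :
    o.2 ≤ 176 * m * numSamples (weight c) ε δ := by
  obtain ⟨-, -, htime⟩ := (sim_monteCarlo c hc U (weight c) ε δ).exists_of_mem_support ho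
  have hN := numSamples_pos (weight_pos hc) hε hδ hδ'
  have hm : 0 < m := by have := U.sites_le; omega
  have hround : n * 21 + m * 28 + 26 ≤ 96 * m := by have := U.sites_le; omega
  have := Nat.mul_pos hm hN
  nlinarith [Nat.mul_le_mul_left (numSamples (weight c) ε δ) hround]

end MonteCarlo

end

end BarrenPlateau

theorem mainTheorem9 :
    ∃ C : ℝ, 0 < C ∧
      ∀ (n q m p : ℕ) [NeZero q] (_hn : 1 ≤ n) (_hq : 2 ≤ q)
        (U : Circuit n q m p)
        (μ : Fin m → MeasureTheory.Measure (Matrix.unitaryGroup (Fin q × Fin q) ℂ))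
        (_hμ : ∀ t, IsTwoDesign (μ t))
        (M : OperatorBasis q) (c : (Fin n → Fin (q ^ 2)) → ℂ) (hc : c ≠ 0)
        (_hH : (M.observable c).IsHermitian)
        (ε δ : ℝ) (_hε : 0 < ε) (_hδ : 0 < δ) (_hδ' : δ < 1),
        -- the output is the empirical average of `N` independent samples
        (U.runMonteCarlo c hc ε δ).map (fun o => o.1.real RReg.out) =
            U.estimator c hc (numSamples (weight c) ε δ) ∧
        -- the error exceeds `ε` with probability at most `δ`
        (U.runMonteCarlo c hc ε δ).toOuterMeasure
            {o | ε < |o.1.real RReg.out - U.secondMoment μ (M.observable c)|} ≤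
          ENNReal.ofReal δ ∧
        -- the running time
        ∀ o ∈ (U.runMonteCarlo c hc ε δ).support,
          (o.2 : ℝ) ≤ C * m * numSamples (weight c) ε δ ∧
          (ε ≤ weight c → δ ≤ 1 / 2 →
            (o.2 : ℝ) ≤ C * (m * weight c ^ 2 * Real.log (1 / δ) * (ε ^ 2)⁻¹)) := by
  refine ⟨528, by norm_num, fun n q m p _ hn hq U μ hμ M c hc hH ε δ hε hδ hδ' => ?_⟩
  have hout := U.map_out_runMonteCarlo c hc ε δ
  refine ⟨hout, ?_, fun o ho => ?_⟩
  · have herror := U.toOuterMeasure_estimator_le hq hμ hc hH hε hδ (by linarith)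
    rw [← hout, PMF.toOuterMeasure_map_apply] at herror
    exact herror
  · have htime : (o.2 : ℝ) ≤ 176 * m * numSamples (weight c) ε δ := by
      exact_mod_cast U.time_runMonteCarlo_le c hc hn hε hδ (by linarith) ho
    refine ⟨htime.trans (by gcongr; norm_num), fun hεS hδ_half => ?_⟩
    calc (o.2 : ℝ) ≤ 176 * m * numSamples (weight c) ε δ := htime
      _ ≤ 176 * m * (3 * (weight c ^ 2 * Real.log (1 / δ) * (ε ^ 2)⁻¹)) := by
          gcongr
          exact numSamples_le hε hδ hεS hδ_half
      _ = 528 * (m * weight c ^ 2 * Real.log (1 / δ) * (ε ^ 2)⁻¹) := by ring
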